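/- \textbf{Setting.} Graphs are finite multigraphs (loops and multiple edges are allowed). Let $G=G(V,E)$ be a connected trivalent graph with at least one vertex; a loop contributes $2$ to the degree of its vertex. A perfect matching of $G$ is a set $M$ of non-loop edges such that each vertex is incident to exactly one edge of $M$; it is even if all cycles of $G\setminus M$ have even length. A $3$-edge-coloring assigns one of three (labelled) colors to each edge such that the three edge-ends at every vertex have different colors. Let $\Gamma$ be an oriented ribbon graph of $G$, i.e. $G$ together with a cyclic order of the edge-ends at each vertex; its surface consists of discs (vertices) joined by untwisted bands (edges). For $\nu\in\{0,1\}^V$ the vertex state $\Gamma_\nu$ is the collection of circles obtained from the boundary of this surface by inserting a half-twist into each of the three bands at $v$, next to $v$, for every vertex $v$ with $\nu_v=1$. More generally, a state $\alpha$ inserts half-twists at an arbitrary set of half-edges. Let $n\ge 1$, $m=\lfloor n/2\rfloor$ and $\widehat V=\mathbb C[x]/(x^n-1)$, and assign to a state $\alpha$ with $k$ circles the space $\widehat V_\alpha=\widehat V^{\otimes k}$. If $\alpha'$ is obtained from $\alpha$ by inserting a half-twist at one more half-edge, define $\widehat V_\alpha\to\widehat V_{\alpha'}$ as the identity on the circles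 that do not pass through this half-edge, and on the other circle(s) as $$x^i\otimes x^j\mapsto x^{i+j},\qquad x^k\mapsto \sum_{0\le i,j<n,\ i+j\equiv k+2m\ (n)} x^i\otimes x^j,\qquad x^k\mapsto \sqrt n\,x^{k+m}$$ (exponents are read modulo $n$) according to whether two circles merge, one circle splits into two, or one circle becomes one circle. For $\nu,\nu'\in\{0,1\}^V$ such that $\nu'$ arises from $\nu$ by changing one entry $\nu_v$ from $0$ to $1$, let $\widehat\delta_{\nu\nu'}\colon\widehat V_\nu\to\widehat V_{\nu'}$ be the composition of three such maps that insert the three half-twists at $v$ one after another (the order does not matter). Give every $\widehat V_\alpha$ the Hermitian metric for which the tensor products of the colors $c_i=\frac1n\sum_{j=0}^{n-1}e^{2\pi \mathrm{i}\, ij/n}x^j$ $(0\le i<n)$, where $\mathrm{i}=\sqrt{-1}$ in the exponent, are orthonormal, and let $\widehat{\mathcal{VCH}}_n(\Gamma_\nu)\subseteq\widehat V_\nu$ be the intersection of the kernels of all maps $\widehat\delta_{\nu\nu'}$ out of $\widehat V_\nu$ and of the adjoints $\widehat\delta_{\nu''\nu}^*$ of all maps into $\widehat V_\nu$. The total matching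 polynomial is $$TM(\Gamma,n)=TM(\Gamma,n,1),\qquad TM(\Gamma,n,t)=\sum_{\nu\in\{0,1\}^V}t^{|\nu|}\dim\widehat{\mathcal{VCH}}_n(\Gamma_\nu),$$ and $TM(G,n):=TM(\Gamma,n)$ for any oriented ribbon graph $\Gamma$ of $G$. \textbf{Theorem.} Let $G(V,E)$ be a connected trivalent graph with at least one vertex, planar or not, and let $M_1,\dots,M_m$ be all its perfect matchings. For every oriented ribbon graph of $G$, the number $TM(G,2)$ computed from it satisfies the following. If $m>0$, then $$TM(G,2)=2^{\frac12|V|}\sum_{i=1}^m 2^{\#\{\text{cycles of }G\setminus M_i\}},$$ and $TM(G,2)=0$ if $m=0$. Consequently $$TM(G,2)\ \ge\ 2^{\frac12|V|}\cdot\#\{3\text{-edge-colorings of }G\},$$ with equality if all perfect matchings of $G$ are even. -/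

import Mathlib

open scoped TensorProduct Graph

namespace VertexHomology

/-! ### Multigraphs -/

section Multigraph

variable {α β : Type*} (G : Graph α β)

/-- The degree of a vertex: a loop counts twice. -/
noncomputable def degree (x : α) : ℕ :=
  {e | G.IsNonloopAt e x}.ncard + 2 * {e | G.IsLoopAt e x}.ncard

/-- Every vertex has degree three. -/
def IsTrivalent : Prop := ∀ x ∈ V(G), degree G x = 3

/-- A graph is connected if it has a vertex and any two vertices are joined by a walk. -/
def IsConnected : Prop :=
  V(G).Nonempty ∧ ∀ x ∈ V(G), ∀ y ∈ V(G), Relation.ReflTransGen G.Adj x y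

/-- A perfect matching: a set of non-loop edges such that each vertex is incident to exactly
one edge of the set. -/
def IsPerfectMatching (M : Set β) : Prop :=
  (∀ e ∈ M, ∃ x, G.IsNonloopAt e x) ∧ ∀ x ∈ V(G), ∃! e, e ∈ M ∧ G.Inc e x

/-- The set `{M₁, …, M_m}` of all perfect matchings. -/
def perfectMatchings : Set (Set β) := {M | IsPerfectMatching G M}

/-- A cycle, given by its edge set: a nonempty set of edges that is connected (any two of its
edges are joined by a chain of edges of the set, consecutive ones sharing a vertex) and in which
every vertex that it meets has degree two. Loops and pairs of parallel edges are cycles. -/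
def IsCycle (C : Set β) : Prop :=
  C.Nonempty ∧ C ⊆ E(G) ∧
  (∀ e ∈ C, ∀ f ∈ C,
    Relation.ReflTransGen (fun a b => b ∈ C ∧ ∃ x, G.Inc a x ∧ G.Inc b x) e f) ∧
  ∀ x, (∃ e ∈ C, G.Inc e x) → degree (G.restrict C) x = 2

/-- The cycles of `G ∖ M`, the graph obtained by deleting the edges in `M`. -/
def cyclesOfCompl (M : Set β) : Set (Set β) := {C | IsCycle (G.deleteEdges M) C}

/-- A perfect matching `M` is even if every cycle of `G ∖ M` has even length. -/
def IsEvenMatching (M : Set β) : Prop := ∀ C ∈ cyclesOfCompl G M, Even C.ncard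

/-- A `3`-edge-coloring: the edge ends at each vertex get different colors. In particular no edge
is a loop. -/
def IsThreeEdgeColoring (c : E(G) → Fin 3) : Prop :=
  (∀ (e : E(G)) (x : α), ¬ G.IsLoopAt (e : β) x) ∧
  ∀ (e f : E(G)) (x : α), e ≠ f → G.Inc (e : β) x → G.Inc (f : β) x → c e ≠ c f

/-- The number of `3`-edge-colorings. -/
noncomputable def numThreeEdgeColorings : ℕ := {c | IsThreeEdgeColoring G c}.ncard

end Multigraph

/-! ### Oriented ribbon graphs -/

/-- An oriented ribbon graph with underlying graph `G`, given combinatorially: `H` is the set of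
half-edges (the ends of the bands). Each half-edge `h` lies on the edge `edge h` and at the vertex
disc `vert h`; `opp h` is the other half of the same edge; and `rot` is the counterclockwise cyclic
order of the half-edges around each vertex disc. No band is twisted, so the surface is oriented. -/
structure OrientedRibbonGraph {α β : Type*} (G : Graph α β) (H : Type*) where
  /-- the vertex of a half-edge -/
  vert : H → V(G)
  /-- the edge of a half-edge -/
  edge : H → E(G)
  /-- the other half of the same edge -/
  opp : H → H
  opp_opp : ∀ h, opp (opp h) = h
  opp_ne : ∀ h, opp h ≠ h
  edge_eq_iff : ∀ h h', edge h = edge h' ↔ h' = h ∨ h' = opp h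
  edge_surjective : Function.Surjective edge
  isLink : ∀ h, G.IsLink (edge h : β) (vert h : α) (vert (opp h) : α)
  /-- the cyclic order at the vertices -/
  rot : Equiv.Perm H
  vert_eq_iff : ∀ h h', vert h = vert h' ↔ rot.SameCycle h h'

/-! ### The algebra and its two bases -/

/-- The algebra `ℂ[x]/(xⁿ - 1)`. -/
abbrev ColorAlgebra (n : ℕ) : Type := AdjoinRoot (Polynomial.X ^ n - 1 : Polynomial ℂ)

section Algebra

variable (n : ℕ) [NeZero n]

theorem monic_X_pow_sub_one : (Polynomial.X ^ n - 1 : Polynomial ℂ).Monic := by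
  simpa using Polynomial.monic_X_pow_sub_C (1 : ℂ) (NeZero.ne n)

theorem natDegree_X_pow_sub_one (n : ℕ) : (Polynomial.X ^ n - 1 : Polynomial ℂ).natDegree = n := by
  simpa using Polynomial.natDegree_X_pow_sub_C (n := n) (r := (1 : ℂ))

/-- The basis `1, x, …, x^{n-1}`. -/
noncomputable def monomialBasis : Module.Basis (Fin n) ℂ (ColorAlgebra n) :=
  (AdjoinRoot.powerBasis' (monic_X_pow_sub_one n)).basis.reindex
    (finCongr (natDegree_X_pow_sub_one n))

theorem monomialBasis_apply (i : Fin n) :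
    monomialBasis n i = AdjoinRoot.root (Polynomial.X ^ n - 1 : Polynomial ℂ) ^ (i : ℕ) := by
  simp only [monomialBasis, Module.Basis.reindex_apply, PowerBasis.basis_eq_pow]
  rfl

/-- The root of unity `λ = exp(2πi/n)`. -/
noncomputable def rootOfUnity (n : ℕ) : ℂ := Complex.exp (2 * Real.pi * Complex.I / n)

/-- The color `c_i = (1/n) (1 + λ^i x + λ^{2i} x² + ⋯ + λ^{(n-1)i} x^{n-1})`. -/
noncomputable def color (i : Fin n) : ColorAlgebra n :=
  ∑ j : Fin n, ((1 / n : ℂ) * rootOfUnity n ^ ((j : ℕ) * (i : ℕ))) • monomialBasis n j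

theorem color_isBasis :
    LinearIndependent ℂ (color n) ∧ Submodule.span ℂ (Set.range (color n)) = ⊤ := by
  rw [(monomialBasis n).is_basis_iff_det, Module.Basis.det_apply]
  have key : (monomialBasis n).toMatrix (color n) =
      (1 / n : ℂ) • (Matrix.vandermonde fun i : Fin n => rootOfUnity n ^ (i : ℕ)).transpose := by
    ext j i
    simp only [Module.Basis.toMatrix_apply, color, map_sum, map_smul, Finsupp.coe_finsetSum,
      Finset.sum_apply, Finsupp.smul_apply, Module.Basis.repr_self, Matrix.smul_apply,
      Matrix.transpose_apply, Matrix.vandermonde_apply, smul_eq_mul]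
    rw [Finset.sum_eq_single j]
    · simp [← pow_mul, mul_comm]
    · intro b _ hb
      simp [hb]
    · simp
  have hprim : IsPrimitiveRoot (rootOfUnity n) n := Complex.isPrimitiveRoot_exp n (NeZero.ne n)
  rw [key, Matrix.det_smul, Matrix.det_transpose, isUnit_iff_ne_zero]
  refine mul_ne_zero (pow_ne_zero _ (by simp [NeZero.ne n])) ?_
  rw [Matrix.det_vandermonde_ne_zero_iff]
  intro i j hij
  exact Fin.ext (hprim.pow_inj i.2 j.2 hij)

/-- The color basis `c_0, …, c_{n-1}`. -/
noncomputable def colorBasis : Module.Basis (Fin n) ℂ (ColorAlgebra n) :=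
  Module.Basis.mk (color_isBasis n).1 (color_isBasis n).2.ge

theorem colorBasis_apply (i : Fin n) : colorBasis n i = color n i := by
  simp [colorBasis]

end Algebra

namespace OrientedRibbonGraph

variable {α β H : Type*} {G : Graph α β} (Γ : OrientedRibbonGraph G H)

/-! ### States of the bubbled blowup

In the bubbled blowup each vertex is replaced by a cycle and each edge by two matching edges with a
bubble between them, so that there is one matching edge for each half-edge `h`. Such a matching
edge has four strand ends: at its vertex end (`inner`) and at its bubble end (`outer`), and there on
its left (`true`) and on its right (`false`), as seen from the vertex. -/

/-- The strand ends: outer or inner, half-edge, left or right. -/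
abbrev StrandEnd (_Γ : OrientedRibbonGraph G H) : Type _ := Bool × H × Bool

/-- The strand end of `h` next to the vertex, on the side `s`. -/
def inner (h : H) (s : Bool) : Γ.StrandEnd := (false, h, s)

/-- The strand end of `h` next to the bubble, on the side `s`. -/
def outer (h : H) (s : Bool) : Γ.StrandEnd := (true, h, s)

/-- The arcs of the state in which the matching edge of `h` gets the smoothing `a h`
(`false` is the `0`-smoothing, two parallel strands; `true` is the `1`-smoothing, two crossing
strands). -/
inductive Arc (a : H → Bool) : Γ.StrandEnd → Γ.StrandEnd → Prop
  | corner (h : H) : Arc a (Γ.inner h true) (Γ.inner (Γ.rot h) false)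
  | bubble (h : H) : Arc a (Γ.outer h true) (Γ.outer (Γ.opp h) false)
  | parallel (h : H) (s : Bool) (ha : a h = false) : Arc a (Γ.inner h s) (Γ.outer h s)
  | crossing (h : H) (s : Bool) (ha : a h = true) : Arc a (Γ.inner h s) (Γ.outer h !s)

/-- The circles of a state: the classes of strand ends under the equivalence relation generated
by the arcs. -/
abbrev Circle (a : H → Bool) : Type _ := Quot (Γ.Arc a)

/-- The circle through a strand end. -/
def circle (a : H → Bool) (p : Γ.StrandEnd) : Γ.Circle a := Quot.mk _ p

/-- The space of a state: a tensor product of one copy of `ℂ[x]/(xⁿ - 1)` for each circle. -/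
abbrev StateSpace (n : ℕ) (a : H → Bool) : Type _ := ⨂[ℂ] _ : Γ.Circle a, ColorAlgebra n

section StateSpace

variable [Finite H] (n : ℕ) [NeZero n]

noncomputable instance (a : H → Bool) : Fintype (Γ.Circle a) := Fintype.ofFinite _

/-- The basis of monomials `⨂ x^{e(c)}`. -/
noncomputable def monomials (a : H → Bool) :
    Module.Basis (Γ.Circle a → Fin n) ℂ (Γ.StateSpace n a) :=
  Basis.piTensorProduct fun _ => monomialBasis n

/-- The basis of colorings `c_I = ⨂ c_{I(c)}`. -/
noncomputable def colorings (a : H → Bool) :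
    Module.Basis (Γ.Circle a → Fin n) ℂ (Γ.StateSpace n a) :=
  Basis.piTensorProduct fun _ => colorBasis n

/-! ### The edge maps in the hypercube of the bubbled blowup -/

open scoped Classical in
/-- The rule `x^s ↦ x^s + x^{s-n}`, where a power occurs only if its exponent is in the allowed
range: this is the coefficient of the output exponent `t`. The summand `x^s` belongs to the maps
`m`, `Δ`, `η` that preserve the quantum grading, and `x^{s-n}` belongs to `m̃`, `Δ̃`, `η̃`. -/
noncomputable def hatCoeff (n s t : ℕ) : ℂ :=
  (if t = s then 1 else 0) + (if t + n = s then 1 else 0)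

open scoped Classical in
/-- The coefficient of the monomial with exponents `e'` in the image of the monomial with exponents
`e` under the edge map from the state `a` to the state `a'`, where `a'` differs from `a` only in that
the smoothing of `h` is changed from `0` to `1`. It is the identity on the circles that do not pass
through `h`. With `m = ⌊n/2⌋`, it is on the other circles
* `x^i ⊗ x^j ↦ x^{i+j}` or `x^{i+j-n}`, if two circles are merged,
* `x^k ↦ ∑ x^i ⊗ x^j` over `i + j = k + 2m` and over `i + j = k + 2m - n`, if a circle is split,
* `x^k ↦ √n x^{k+m}` or `√n x^{k+m-n}`, if a circle is changed into one circle. -/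
noncomputable def edgeCoeff (a a' : H → Bool) (h : H)
    (e : Γ.Circle a → Fin n) (e' : Γ.Circle a' → Fin n) : ℂ :=
  let l := Γ.circle a (Γ.inner h true)
  let r := Γ.circle a (Γ.inner h false)
  let l' := Γ.circle a' (Γ.inner h true)
  let r' := Γ.circle a' (Γ.inner h false)
  if ∀ p, Γ.circle a p ≠ l → Γ.circle a p ≠ r → e' (Γ.circle a' p) = e (Γ.circle a p) then
    if l ≠ r then hatCoeff n ((e l : ℕ) + (e r : ℕ)) (e' l' : ℕ)
    else if l' ≠ r' then hatCoeff n ((e l : ℕ) + 2 * (n / 2)) ((e' l' : ℕ) + (e' r' : ℕ))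
    else (Real.sqrt n : ℂ) * hatCoeff n ((e l : ℕ) + n / 2) (e' l' : ℕ)
  else 0

open scoped Classical in
/-- The map `∂̂ = ∂ + ∂̃` along the edge from `a` to `a'` that changes the smoothing of `h`. -/
noncomputable def edgeMap (a a' : H → Bool) (h : H) : Γ.StateSpace n a →ₗ[ℂ] Γ.StateSpace n a' :=
  (Γ.monomials n a).constr ℂ fun e => ∑ e', Γ.edgeCoeff n a a' h e e' • Γ.monomials n a' e'

/-! ### The metric -/

open scoped Classical in
/-- The Hermitian metric for which the colorings are orthonormal (linear in the first argument). -/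
noncomputable def metric (a : H → Bool) (x y : Γ.StateSpace n a) : ℂ :=
  ∑ I, (Γ.colorings n a).repr x I * starRingEnd ℂ ((Γ.colorings n a).repr y I)

open scoped Classical in
/-- The adjoint of a linear map between state spaces with respect to the metrics. -/
noncomputable def adjoint {a a' : H → Bool} (f : Γ.StateSpace n a →ₗ[ℂ] Γ.StateSpace n a') :
    Γ.StateSpace n a' →ₗ[ℂ] Γ.StateSpace n a :=
  Matrix.toLin (Γ.colorings n a') (Γ.colorings n a)
    (LinearMap.toMatrix (Γ.colorings n a) (Γ.colorings n a') f).conjTranspose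

theorem metric_adjoint {a a' : H → Bool} (f : Γ.StateSpace n a →ₗ[ℂ] Γ.StateSpace n a')
    (x : Γ.StateSpace n a) (y : Γ.StateSpace n a') :
    Γ.metric n a' (f x) y = Γ.metric n a x (Γ.adjoint n f y) := by
  classical
  have h1 : ∀ J, (Γ.colorings n a').repr (f x) J =
      ∑ I, LinearMap.toMatrix (Γ.colorings n a) (Γ.colorings n a') f J I *
        (Γ.colorings n a).repr x I := fun J => by
    rw [← LinearMap.toMatrix_mulVec_repr (Γ.colorings n a) (Γ.colorings n a') f x]
    rfl
  have h2 : ∀ I, (Γ.colorings n a).repr (Γ.adjoint n f y) I =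
      ∑ J, starRingEnd ℂ (LinearMap.toMatrix (Γ.colorings n a) (Γ.colorings n a') f J I) *
        (Γ.colorings n a').repr y J := fun I => by
    rw [← LinearMap.toMatrix_mulVec_repr (Γ.colorings n a') (Γ.colorings n a) (Γ.adjoint n f) y,
      adjoint]
    rw [LinearMap.toMatrix_toLin]
    rfl
  simp only [metric, h1, h2, map_sum, map_mul, Complex.conj_conj, Finset.sum_mul, Finset.mul_sum]
  rw [Finset.sum_comm]
  refine Finset.sum_congr rfl fun I _ => Finset.sum_congr rfl fun J _ => by ring

/-! ### The hypercube of vertex states and the harmonic spaces -/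

/-- A vertex state `ν`, as a state of the bubbled blowup: all matching edges around a vertex get
the smoothing of that vertex. -/
def ofVertexState (ν : V(G) → Bool) : H → Bool := fun h => ν (Γ.vert h)

/-- The space `V̂_ν` of a vertex state. -/
abbrev VertexSpace (n : ℕ) (ν : V(G) → Bool) : Type _ := Γ.StateSpace n (Γ.ofVertexState ν)

open scoped Classical in
/-- The composition of the three edge maps along the path from `ν` to `ν'` in the hypercube of the
bubbled blowup that changes the smoothings of the three half-edges `h`, `rot h`, `rot (rot h)` in
this order. Here `ν'` is obtained from `ν` by a vertex `1`-smoothing at the vertex of `h`. -/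
noncomputable def pathMap (ν ν' : V(G) → Bool) (h : H) :
    Γ.VertexSpace n ν →ₗ[ℂ] Γ.VertexSpace n ν' :=
  let a₀ := Γ.ofVertexState ν
  let a₁ := Function.update a₀ h true
  let a₂ := Function.update a₁ (Γ.rot h) true
  let a₃ := Γ.ofVertexState ν'
  Γ.edgeMap n a₂ a₃ (Γ.rot (Γ.rot h)) ∘ₗ Γ.edgeMap n a₁ a₂ (Γ.rot h) ∘ₗ Γ.edgeMap n a₀ a₁ h

open scoped Classical in
/-- The local differential `δ̂_{νν'}` of the edge from `ν` to `ν'` that changes the smoothing of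
the vertex `v`: the map along a path of three edges (the choice of which does not matter). -/
noncomputable def localDifferential (ν ν' : V(G) → Bool) (v : V(G)) :
    Γ.VertexSpace n ν →ₗ[ℂ] Γ.VertexSpace n ν' :=
  if hv : ∃ h, Γ.vert h = v then Γ.pathMap n ν ν' hv.choose else 0

open scoped Classical in
/-- The map `δ̂_ν` from `V̂_ν` to the direct sum of the spaces of the next states. -/
noncomputable def stateDifferential (ν : V(G) → Bool) :
    Γ.VertexSpace n ν →ₗ[ℂ]
      (∀ v : {v : V(G) // ν v = false}, Γ.VertexSpace n (Function.update ν v true)) :=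
  LinearMap.pi fun v => Γ.localDifferential n ν (Function.update ν v true) v

open scoped Classical in
/-- The map `δ̂_ν^*` from `V̂_ν` to the direct sum of the spaces of the previous states. -/
noncomputable def stateAdjoint (ν : V(G) → Bool) :
    Γ.VertexSpace n ν →ₗ[ℂ]
      (∀ v : {v : V(G) // ν v = true}, Γ.VertexSpace n (Function.update ν v false)) :=
  LinearMap.pi fun v => Γ.adjoint n (Γ.localDifferential n (Function.update ν v false) ν v)

/-- The harmonic mixtures of a vertex state. -/
noncomputable def harmonicSpace (ν : V(G) → Bool) : Submodule ℂ (Γ.VertexSpace n ν) :=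
  LinearMap.ker (Γ.stateDifferential n ν) ⊓ LinearMap.ker (Γ.stateAdjoint n ν)

/-- The two-variable total matching polynomial `TM(Γ, n, t)`, as a polynomial in `t`. -/
noncomputable def totalMatchingPolynomial₂ : Polynomial ℕ :=
  ∑ᶠ ν : V(G) → Bool,
    Polynomial.monomial {v | ν v = true}.ncard (Module.finrank ℂ (Γ.harmonicSpace n ν))

/-- The total matching polynomial `TM(Γ, n) = TM(Γ, n, 1)`. -/
noncomputable def totalMatchingPolynomial : ℕ := (Γ.totalMatchingPolynomial₂ n).eval 1

end StateSpace

end OrientedRibbonGraph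

end VertexHomology

/-! ### Circles of states and how they change at one half-edge -/

namespace VertexHomology
namespace OrientedRibbonGraph

variable {α β H : Type*} {G : Graph α β} (Γ : OrientedRibbonGraph G H)

/-! For two colors, multiplication by `x` acts on the colors `c_0`, `c_1` by the signs `1`, `-1`.
Each edge map commutes with multiplication by `x` on the circle through any given strand end
(`shift_edgeMap`). Comparing eigenvalues, an edge map sends a coloring of circles to a multiple of
the one coloring that gives every strand end the same color, or to zero if there is none; a
positivity argument shows that the multiple is nonzero. This property, `IsAgreeMap`, passes to
compositions along paths and to adjoints. Hence all kernels in question are spanned by colorings,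
and the harmonic space of a vertex state is spanned by the colorings for which no vertex has three
corners of one color (`mem_harmonicSpace_iff`).

So `TM(G,2)` counts pairs of a vertex state `ν` and such a coloring, equivalently a coloring `f` of
the corners that fits along the edges. With two colors on three corners, not all equal, exactly one
half-edge at each vertex has the same color on both sides. Half-twists only swap sides, so both
halves of an edge behave alike and these edges form a perfect matching `M`. For fixed `M`, the color
along each edge of `M` is free, which gives the factor `2^(|V|/2)`. On the remaining half-edges `f
xor ν` flips along every edge and at every vertex, so it amounts to an orientation of each cycle of
`G ∖ M`; it determines `ν`. This is `card_matches`.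

A `3`-edge-coloring consists of the perfect matching of color `0` and an alternating coloring of the
cycles of its complement. Each `M` therefore carries at most `2^#cycles` of them, and exactly that
many if all cycles are even. Orientations and alternating colorings are both treated as labelings
with prescribed behavior under two involutions on half-edges (`Labeling`). -/

theorem circle_eq_of_arc {a : H → Bool} {p q : Γ.StrandEnd} (h : Γ.Arc a p q) :
    Γ.circle a p = Γ.circle a q := Quot.sound h

theorem circle_surjective (a : H → Bool) : Function.Surjective (Γ.circle a) := Quot.exists_rep

theorem apply_eq_of_circle_eq {a : H → Bool} {X : Type*} (χ : Γ.StrandEnd → X)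
    (hχ : ∀ p q, Γ.Arc a p q → χ p = χ q) {p q : Γ.StrandEnd}
    (h : Γ.circle a p = Γ.circle a q) : χ p = χ q :=
  congrArg (Quot.lift χ hχ) h

/-- The strand end `p` lies on a circle through the matching edge of `h`. -/
def Through (a : H → Bool) (h : H) (p : Γ.StrandEnd) : Prop :=
  Γ.circle a p = Γ.circle a (Γ.inner h true) ∨ Γ.circle a p = Γ.circle a (Γ.inner h false)

theorem through_inner (a : H → Bool) (h : H) (s : Bool) : Γ.Through a h (Γ.inner h s) := by
  cases s
  · exact Or.inr rfl
  · exact Or.inl rfl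

theorem through_of_circle_eq {a : H → Bool} {h : H} {p q : Γ.StrandEnd}
    (hpq : Γ.circle a p = Γ.circle a q) : Γ.Through a h p ↔ Γ.Through a h q := by
  simp only [Through, hpq]

theorem through_outer (a : H → Bool) (h : H) (s : Bool) : Γ.Through a h (Γ.outer h s) := by
  cases ha : a h
  · exact (Γ.through_of_circle_eq (Γ.circle_eq_of_arc (Arc.parallel h s ha))).1
      (Γ.through_inner a h s)
  · have := (Γ.through_of_circle_eq (Γ.circle_eq_of_arc (Arc.crossing h (!s) ha))).1
      (Γ.through_inner a h (!s))
    simpa using this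

/-- An arc of a state is an arc of any state that agrees away from `h`, or else it belongs to the
matching edge of `h`. -/
theorem arc_or_through {a a' : H → Bool} {h : H} (haa' : ∀ k, k ≠ h → a k = a' k)
    {p q : Γ.StrandEnd} (hpq : Γ.Arc a' p q) :
    Γ.Arc a p q ∨ ∀ b : H → Bool, Γ.Through b h p ∧ Γ.Through b h q := by
  cases hpq with
  | corner k => exact Or.inl (Arc.corner k)
  | bubble k => exact Or.inl (Arc.bubble k)
  | parallel k s hk =>
    by_cases hkh : k = h
    · subst hkh
      exact Or.inr fun b => ⟨Γ.through_inner b k s, Γ.through_outer b k s⟩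
    · exact Or.inl (Arc.parallel k s (by rw [haa' k hkh, hk]))
  | crossing k s hk =>
    by_cases hkh : k = h
    · subst hkh
      exact Or.inr fun b => ⟨Γ.through_inner b k s, Γ.through_outer b k _⟩
    · exact Or.inl (Arc.crossing k s (by rw [haa' k hkh, hk]))

/-- Changing the smoothing at `h` rewires only the four strand ends of `h`. In either state these
lie on circles through `h`, so `Through a h` is constant along the arcs of `a'` too. -/
theorem Through.transfer {a a' : H → Bool} {h : H} (haa' : ∀ k, k ≠ h → a k = a' k)
    {p : Γ.StrandEnd} (hp : Γ.Through a' h p) : Γ.Through a h p := by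
  have key : ∀ q q', Γ.Arc a' q q' → Γ.Through a h q = Γ.Through a h q' := by
    intro q q' hqq'
    rcases Γ.arc_or_through haa' hqq' with h1 | h1
    · exact propext (Γ.through_of_circle_eq (Γ.circle_eq_of_arc h1))
    · exact propext ⟨fun _ => (h1 a).2, fun _ => (h1 a).1⟩
  rcases hp with hp | hp
  · rw [Γ.apply_eq_of_circle_eq (Γ.Through a h) key hp]
    exact Γ.through_inner a h true
  · rw [Γ.apply_eq_of_circle_eq (Γ.Through a h) key hp]
    exact Γ.through_inner a h false

theorem through_congr {a a' : H → Bool} {h : H} (haa' : ∀ k, k ≠ h → a k = a' k)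
    (p : Γ.StrandEnd) : Γ.Through a h p ↔ Γ.Through a' h p :=
  ⟨Through.transfer Γ fun k hk => (haa' k hk).symm, Through.transfer Γ haa'⟩

/-- A circle that avoids `h` uses only arcs common to both states. Collapsing all circles through
`h` to `none` yields a function that is constant along every arc of `a`. -/
theorem circle_eq_of_not_through {a a' : H → Bool} {h : H} (haa' : ∀ k, k ≠ h → a k = a' k)
    {p q : Γ.StrandEnd} (hp : ¬ Γ.Through a h p) (hpq : Γ.circle a p = Γ.circle a q) :
    Γ.circle a' p = Γ.circle a' q := by
  classical
  let χ : Γ.StrandEnd → Option (Γ.Circle a') :=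
    fun x => if Γ.Through a h x then none else some (Γ.circle a' x)
  have key : ∀ x y, Γ.Arc a x y → χ x = χ y := by
    intro x y hxy
    have h0 := Γ.through_of_circle_eq (h := h) (Γ.circle_eq_of_arc hxy)
    rcases Γ.arc_or_through (fun k hk => (haa' k hk).symm) hxy with h1 | h1
    · simp only [χ, h0, Γ.circle_eq_of_arc h1]
    · simp only [χ, (h1 a).1, (h1 a).2, if_true]
  have h1 := Γ.apply_eq_of_circle_eq χ key hpq
  have hq : ¬ Γ.Through a h q := fun hq => hp ((Γ.through_of_circle_eq hpq).2 hq)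
  simpa [χ, hp, hq] using h1

theorem circle_eq_iff_of_not_through {a a' : H → Bool} {h : H} (haa' : ∀ k, k ≠ h → a k = a' k)
    {p q : Γ.StrandEnd} (hp : ¬ Γ.Through a h p) :
    Γ.circle a p = Γ.circle a q ↔ Γ.circle a' p = Γ.circle a' q :=
  ⟨Γ.circle_eq_of_not_through haa' hp,
    Γ.circle_eq_of_not_through (fun k hk => (haa' k hk).symm)
      fun h1 => hp ((Γ.through_congr haa' p).2 h1)⟩

/-- The strand end at the other side of a corner or of a bubble. -/
def across : Γ.StrandEnd → Γ.StrandEnd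
  | (false, h, true) => (false, Γ.rot h, false)
  | (false, h, false) => (false, Γ.rot.symm h, true)
  | (true, h, s) => (true, Γ.opp h, !s)

theorem across_across (p : Γ.StrandEnd) : Γ.across (Γ.across p) = p := by
  rcases p with ⟨_ | _, h, _ | _⟩ <;> simp [across, Γ.opp_opp]

theorem across_ne (p : Γ.StrandEnd) : Γ.across p ≠ p := by
  rcases p with ⟨_ | _, h, _ | _⟩ <;> simp [across]

theorem circle_across (a : H → Bool) (p : Γ.StrandEnd) :
    Γ.circle a (Γ.across p) = Γ.circle a p := by
  rcases p with ⟨_ | _, h, _ | _⟩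
  · have := Γ.circle_eq_of_arc (Arc.corner (a := a) (Γ.rot.symm h))
    rw [Equiv.apply_symm_apply] at this
    exact this
  · exact (Γ.circle_eq_of_arc (Arc.corner (a := a) h)).symm
  · have := Γ.circle_eq_of_arc (Arc.bubble (a := a) (Γ.opp h))
    rw [Γ.opp_opp] at this
    exact this
  · exact (Γ.circle_eq_of_arc (Arc.bubble (a := a) h)).symm

/-- The strand end at the other end of a strand of a matching edge. -/
def along (a : H → Bool) (p : Γ.StrandEnd) : Γ.StrandEnd := (!p.1, p.2.1, xor p.2.2 (a p.2.1))

theorem along_along (a : H → Bool) (p : Γ.StrandEnd) : Γ.along a (Γ.along a p) = p := by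
  simp [along]

theorem along_ne (a : H → Bool) (p : Γ.StrandEnd) : Γ.along a p ≠ p := by
  intro h
  simpa [along] using congrArg Prod.fst h

theorem circle_along (a : H → Bool) (p : Γ.StrandEnd) :
    Γ.circle a (Γ.along a p) = Γ.circle a p := by
  obtain ⟨b, h, s⟩ := p
  cases ha : a h
  · have := Γ.circle_eq_of_arc (Arc.parallel h s ha)
    cases b
    · simpa [along, ha, inner, outer] using this.symm
    · simpa [along, ha, inner, outer] using this
  · cases b
    · have := Γ.circle_eq_of_arc (Arc.crossing h s ha)
      simpa [along, ha, inner, outer] using this.symm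
    · have := Γ.circle_eq_of_arc (Arc.crossing h (!s) ha)
      simpa [along, ha, inner, outer] using this

theorem even_card_of_involution {X : Type*} (S : Finset X) (τ : X → X) (hτ : ∀ x, τ (τ x) = x)
    (hne : ∀ x, τ x ≠ x) (hS : ∀ x ∈ S, τ x ∈ S) : Even S.card := by
  have : ∑ _x ∈ S, (1 : ZMod 2) = 0 :=
    Finset.sum_involution (fun x _ => τ x) (fun _ _ => by decide) (fun x _ _ => hne x) hS
      (fun x _ => hτ x)
  rw [Finset.sum_const, nsmul_one] at this
  exact (ZMod.natCast_eq_zero_iff_even).1 this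

/-- If two circles pass through a matching edge with parallel strands, then they are merged by
crossing the strands. -/
theorem circle_merge [Finite H] {a a' : H → Bool} {h : H} (haa' : ∀ k, k ≠ h → a k = a' k)
    (ha : a h = false) (ha' : a' h = true)
    (hne : Γ.circle a (Γ.inner h true) ≠ Γ.circle a (Γ.inner h false)) :
    Γ.circle a' (Γ.inner h true) = Γ.circle a' (Γ.inner h false) := by
  classical
  by_contra hne'
  have := Fintype.ofFinite H
  -- Parity argument: if both states kept the two strands on different circles, `inner h true` would
  -- be the only strand end of `h` in `S`. The involution `across` pairs up the elements of `S`,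
  -- while `along` pairs up those other than `inner h true`, so `S.card` and `S.card - 1` would both
  -- be even.
  let S : Finset Γ.StrandEnd := Finset.univ.filter fun p =>
    Γ.circle a p = Γ.circle a (Γ.inner h true) ∧ Γ.circle a' p = Γ.circle a' (Γ.inner h true)
  have hS : ∀ p, p ∈ S ↔ Γ.circle a p = Γ.circle a (Γ.inner h true) ∧
      Γ.circle a' p = Γ.circle a' (Γ.inner h true) := fun p => by simp [S]
  have h1 : Even S.card := even_card_of_involution S Γ.across Γ.across_across Γ.across_ne
    fun p hp => by rw [hS, circle_across, circle_across, ← hS]; exact hp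
  have hmem : Γ.inner h true ∈ S := (hS _).2 ⟨rfl, rfl⟩
  have hend : ∀ p ∈ S, p.2.1 = h → p = Γ.inner h true := by
    rintro ⟨b, k, s⟩ hp rfl
    rw [hS] at hp
    have e1 := Γ.circle_eq_of_arc (Arc.parallel k s ha)
    have e2 := Γ.circle_eq_of_arc (Arc.crossing k (!s) ha')
    rw [Bool.not_not] at e2
    cases b <;> cases s
    · exact absurd hp.1.symm hne
    · rfl
    · exact absurd (e1.trans hp.1).symm hne
    · exact absurd (e2.trans hp.2).symm hne'
  have h2 : Even (S.erase (Γ.inner h true)).card :=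
    even_card_of_involution _ (Γ.along a) (Γ.along_along a) (Γ.along_ne a) fun p hp => by
      rw [Finset.mem_erase] at hp ⊢
      have hph : p.2.1 ≠ h := fun hph => hp.1 (hend p hp.2 hph)
      refine ⟨fun h3 => hph (congrArg (fun q => q.2.1) h3), ?_⟩
      rw [hS, circle_along]
      have : Γ.along a p = Γ.along a' p := by simp [along, haa' _ hph]
      rw [this, circle_along, ← hS]
      exact hp.2
  rw [Finset.card_erase_of_mem hmem] at h2
  have h3 : 0 < S.card := Finset.card_pos.2 ⟨_, hmem⟩
  obtain ⟨x, hx⟩ := h1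
  obtain ⟨y, hy⟩ := h2
  omega

/-! ### Agreeing colorings of different states -/

/-- Colorings of the circles of two states agree if every strand end gets the same color. -/
def Agree {a a' : H → Bool} {X : Type*} (I : Γ.Circle a → X) (J : Γ.Circle a' → X) : Prop :=
  ∀ p, I (Γ.circle a p) = J (Γ.circle a' p)

variable {Γ}

theorem Agree.trans {a b c : H → Bool} {X : Type*} {I : Γ.Circle a → X} {J : Γ.Circle b → X}
    {K : Γ.Circle c → X} (h1 : Γ.Agree I J) (h2 : Γ.Agree J K) : Γ.Agree I K :=
  fun p => (h1 p).trans (h2 p)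

theorem Agree.symm {a b : H → Bool} {X : Type*} {I : Γ.Circle a → X} {J : Γ.Circle b → X}
    (h : Γ.Agree I J) : Γ.Agree J I := fun p => (h p).symm

theorem Agree.unique {a b : H → Bool} {X : Type*} {I : Γ.Circle a → X} {J J' : Γ.Circle b → X}
    (h : Γ.Agree I J) (h' : Γ.Agree I J') : J = J' := by
  funext c
  obtain ⟨p, rfl⟩ := Γ.circle_surjective b c
  rw [← h p, h' p]

/-- Agreeing colorings of two states induce a coloring of any state between them. -/
theorem Agree.exists_between {a b c : H → Bool} {X : Type*} {I : Γ.Circle a → X}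
    {K : Γ.Circle c → X} (hIK : Γ.Agree I K) (hb : ∀ k, b k = a k ∨ b k = c k) :
    ∃ J : Γ.Circle b → X, Γ.Agree I J := by
  have hI : ∀ p q, Γ.Arc a p q → I (Γ.circle a p) = I (Γ.circle a q) :=
    fun p q h => congrArg I (Γ.circle_eq_of_arc h)
  -- As a function of strand ends, `I` is also constant along the arcs of `c`; every arc of `b` is
  -- an arc of `a` or of `c`.
  have hK : ∀ p q, Γ.Arc c p q → I (Γ.circle a p) = I (Γ.circle a q) := fun p q h => by
    rw [hIK p, hIK q, Γ.circle_eq_of_arc h]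
  refine ⟨Quot.lift (fun p => I (Γ.circle a p)) ?_, fun p => rfl⟩
  intro p q hpq
  cases hpq with
  | corner k => exact hI _ _ (Arc.corner k)
  | bubble k => exact hI _ _ (Arc.bubble k)
  | parallel k s hk =>
    rcases hb k with h | h
    · exact hI _ _ (Arc.parallel k s (h ▸ hk))
    · exact hK _ _ (Arc.parallel k s (h ▸ hk))
  | crossing k s hk =>
    rcases hb k with h | h
    · exact hI _ _ (Arc.crossing k s (h ▸ hk))
    · exact hK _ _ (Arc.crossing k s (h ▸ hk))

end OrientedRibbonGraph
end VertexHomology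

namespace VertexHomology

/-! ### The algebra for two colors -/

theorem rootOfUnity_two : rootOfUnity 2 = -1 := by
  rw [rootOfUnity, ← Complex.exp_pi_mul_I]
  congr 1
  push_cast
  ring

theorem root_mul_root :
    (AdjoinRoot.root (Polynomial.X ^ 2 - 1 : Polynomial ℂ)) *
      AdjoinRoot.root (Polynomial.X ^ 2 - 1 : Polynomial ℂ) = 1 := by
  have h := AdjoinRoot.eval₂_root (Polynomial.X ^ 2 - 1 : Polynomial ℂ)
  simp only [Polynomial.eval₂_sub, Polynomial.eval₂_X_pow, Polynomial.eval₂_one] at h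
  rw [← sq]
  exact sub_eq_zero.1 h

/-- The sign `(-1)^i`. -/
def colorSign (i : Fin 2) : ℂ := (-1) ^ (i : ℕ)

theorem colorSign_injective : Function.Injective colorSign := by
  intro i j h
  fin_cases i <;> fin_cases j <;> first | rfl | (norm_num [colorSign] at h)

theorem root_mul_monomialBasis (i : Fin 2) :
    AdjoinRoot.root (Polynomial.X ^ 2 - 1 : Polynomial ℂ) * monomialBasis 2 i =
      monomialBasis 2 (i + 1) := by
  fin_cases i <;> simp [monomialBasis_apply, root_mul_root]

theorem monomialBasis_repr_color (i j : Fin 2) :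
    (monomialBasis 2).repr (color 2 i) j = 1 / 2 * (-1) ^ ((j : ℕ) * (i : ℕ)) := by
  simp only [color, map_sum, map_smul, Finsupp.coe_finsetSum, Finset.sum_apply,
    Finsupp.smul_apply, Module.Basis.repr_self, smul_eq_mul, rootOfUnity_two]
  rw [Finset.sum_eq_single j]
  · simp
  · intro b _ hb
    simp [hb]
  · simp

/-- Here `c_0 = (1 + x)/2` and `c_1 = (1 - x)/2`. The two eigenvalues of `x` differ, so colors can
be read off from the action of `x`. -/
theorem root_mul_color (i : Fin 2) :
    AdjoinRoot.root (Polynomial.X ^ 2 - 1 : Polynomial ℂ) * color 2 i =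
      colorSign i • color 2 i := by
  simp only [color, Fin.sum_univ_two, mul_add, mul_smul_comm, root_mul_monomialBasis,
    rootOfUnity_two]
  fin_cases i <;> simp [colorSign, add_comm]

/-- In the window `t - 1 ≤ s < t + 4` the rule "`t = s` or `t + 2 = s`" is just congruence modulo
`2`. The exponents in all three kinds of edge map stay inside this window. -/
theorem hatCoeff_two_eq_iff {s t s' t' : ℕ} (hs : s < t + 4) (hs' : s' < t' + 4) (ht : t ≤ s + 1)
    (ht' : t' ≤ s' + 1) (h : (s + t) % 2 = (s' + t') % 2) :
    OrientedRibbonGraph.hatCoeff 2 s t = OrientedRibbonGraph.hatCoeff 2 s' t' := by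
  have key : ∀ s t : ℕ, s < t + 4 → t ≤ s + 1 →
      OrientedRibbonGraph.hatCoeff 2 s t = if (s + t) % 2 = 0 then 1 else 0 := by
    intro s t h1 h2
    unfold OrientedRibbonGraph.hatCoeff
    by_cases h3 : t = s
    · rw [if_pos h3, if_neg (by omega), if_pos (by omega), add_zero]
    · by_cases h4 : t + 2 = s
      · rw [if_neg h3, if_pos h4, if_pos (by omega), zero_add]
      · rw [if_neg h3, if_neg h4, if_neg (by omega), add_zero]
  rw [key s t hs ht, key s' t' hs' ht', h]

/-! ### Multiplication by `x` at a strand end commutes with the edge maps -/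

namespace OrientedRibbonGraph

variable {α β H : Type*} {G : Graph α β} (Γ : OrientedRibbonGraph G H) [Finite H]

open scoped Classical in
/-- Multiplication by `x` on the tensor factor of a circle. -/
noncomputable def shift (a : H → Bool) (q : Γ.Circle a) :
    Γ.StateSpace 2 a →ₗ[ℂ] Γ.StateSpace 2 a :=
  PiTensorProduct.map fun c => if c = q then
    LinearMap.mulLeft ℂ (AdjoinRoot.root (Polynomial.X ^ 2 - 1 : Polynomial ℂ)) else LinearMap.id

open scoped Classical in
theorem shift_monomials (a : H → Bool) (q : Γ.Circle a) (e : Γ.Circle a → Fin 2) :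
    Γ.shift a q (Γ.monomials 2 a e) = Γ.monomials 2 a (e + Pi.single q 1) := by
  rw [shift, monomials, Basis.piTensorProduct_apply, Basis.piTensorProduct_apply,
    PiTensorProduct.map_tprod]
  congr 1
  funext c
  by_cases hc : c = q
  · subst hc
    rw [if_pos rfl, LinearMap.mulLeft_apply, root_mul_monomialBasis]
    simp
  · simp [hc]

open scoped Classical in
theorem shift_colorings (a : H → Bool) (q : Γ.Circle a) (I : Γ.Circle a → Fin 2) :
    Γ.shift a q (Γ.colorings 2 a I) = colorSign (I q) • Γ.colorings 2 a I := by
  rw [shift, colorings, Basis.piTensorProduct_apply, PiTensorProduct.map_tprod]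
  have : (fun c => (if c = q then
      LinearMap.mulLeft ℂ (AdjoinRoot.root (Polynomial.X ^ 2 - 1 : Polynomial ℂ))
      else LinearMap.id) (colorBasis 2 (I c))) =
      fun c => (if c = q then colorSign (I c) else 1) • colorBasis 2 (I c) := by
    funext c
    by_cases hc : c = q
    · rw [if_pos hc, if_pos hc, LinearMap.mulLeft_apply, colorBasis_apply, root_mul_color]
    · simp [hc]
  rw [this, MultilinearMap.map_smul_univ]
  simp

theorem colorings_repr_shift (a : H → Bool) (q : Γ.Circle a) (x : Γ.StateSpace 2 a)
    (J : Γ.Circle a → Fin 2) :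
    (Γ.colorings 2 a).repr (Γ.shift a q x) J = colorSign (J q) * (Γ.colorings 2 a).repr x J := by
  classical
  have : (Finsupp.lapply J ∘ₗ (Γ.colorings 2 a).repr.toLinearMap) ∘ₗ Γ.shift a q =
      colorSign (J q) • (Finsupp.lapply J ∘ₗ (Γ.colorings 2 a).repr.toLinearMap) := by
    refine (Γ.colorings 2 a).ext fun I => ?_
    simp only [LinearMap.comp_apply, shift_colorings, map_smul, LinearEquiv.coe_coe,
      Module.Basis.repr_self, LinearMap.smul_apply, Finsupp.lapply_apply, smul_eq_mul]
    by_cases h : I = J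
    · rw [h]
    · simp [h]
  exact LinearMap.congr_fun this x

theorem monomials_repr_colorings (a : H → Bool) (I e : Γ.Circle a → Fin 2) :
    (Γ.monomials 2 a).repr (Γ.colorings 2 a I) e =
      ∏ c, (1 / 2 * (-1) ^ ((e c : ℕ) * (I c : ℕ)) : ℂ) := by
  rw [colorings, Basis.piTensorProduct_apply, monomials, Basis.piTensorProduct_repr_tprod_apply]
  exact Finset.prod_congr rfl fun c _ => by rw [colorBasis_apply, monomialBasis_repr_color]

open scoped Classical in
/-- The edge coefficients are invariant under multiplication by `x` at a strand end. -/
theorem edgeCoeff_shift {a a' : H → Bool} {h : H} (haa' : ∀ k, k ≠ h → a k = a' k)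
    (ha : a h = false) (ha' : a' h = true) (p : Γ.StrandEnd)
    (e : Γ.Circle a → Fin 2) (e' : Γ.Circle a' → Fin 2) :
    Γ.edgeCoeff 2 a a' h (e + Pi.single (Γ.circle a p) 1) (e' + Pi.single (Γ.circle a' p) 1) =
      Γ.edgeCoeff 2 a a' h e e' := by
  have single_self : ∀ {b : H → Bool} (d : Γ.Circle b → Fin 2) (c : Γ.Circle b),
      (d + Pi.single c 1 : Γ.Circle b → Fin 2) c = d c + 1 := fun d c => by simp
  have single_ne : ∀ {b : H → Bool} (d : Γ.Circle b → Fin 2) {c c' : Γ.Circle b}, c' ≠ c →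
      (d + Pi.single c 1 : Γ.Circle b → Fin 2) c' = d c' := fun d c c' hc => by simp [hc]
  have hcond : (∀ q, Γ.circle a q ≠ Γ.circle a (Γ.inner h true) →
      Γ.circle a q ≠ Γ.circle a (Γ.inner h false) →
      (e' + Pi.single (Γ.circle a' p) 1 : Γ.Circle a' → Fin 2) (Γ.circle a' q) =
        (e + Pi.single (Γ.circle a p) 1 : Γ.Circle a → Fin 2) (Γ.circle a q)) ↔
      ∀ q, Γ.circle a q ≠ Γ.circle a (Γ.inner h true) →
        Γ.circle a q ≠ Γ.circle a (Γ.inner h false) →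
        e' (Γ.circle a' q) = e (Γ.circle a q) := by
    refine forall_congr' fun q => forall_congr' fun h1 => forall_congr' fun h2 => ?_
    have hq : ¬ Γ.Through a h q := by simp [Through, h1, h2]
    have hqp := Γ.circle_eq_iff_of_not_through haa' hq (q := p)
    by_cases hpq : Γ.circle a q = Γ.circle a p
    · rw [← hpq, ← hqp.1 hpq, single_self, single_self, add_left_inj]
    · rw [single_ne _ hpq, single_ne _ (fun h3 => hpq (hqp.2 h3))]
  unfold edgeCoeff
  simp only [hcond]
  by_cases hp : Γ.Through a h p
  · have hp' := (Γ.through_congr haa' p).1 hp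
    -- If `p` lies on a circle through `h`, the shift changes exactly one exponent in each argument
    -- of `hatCoeff`, by `±1`, so the parity of the sum of the arguments is preserved in each of the
    -- three cases.
    have plus : ∀ i : Fin 2, ((i + 1 : Fin 2) : ℕ) + i = 1 := by decide
    have lt : ∀ i : Fin 2, (i : ℕ) < 2 := fun i => i.2
    congr 1
    by_cases hlr : Γ.circle a (Γ.inner h true) = Γ.circle a (Γ.inner h false)
    · have hpl : Γ.circle a p = Γ.circle a (Γ.inner h true) := by
        rcases hp with hp | hp
        · exact hp
        · rw [hp, hlr]
      simp only [hlr, ne_eq, not_true_eq_false, if_false] at hpl ⊢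
      rw [hpl, single_self]
      have := plus (e (Γ.circle a (Γ.inner h false)))
      have := lt (e (Γ.circle a (Γ.inner h false)))
      by_cases hlr' : Γ.circle a' (Γ.inner h true) = Γ.circle a' (Γ.inner h false)
      · have hpl' : Γ.circle a' p = Γ.circle a' (Γ.inner h true) := by
          rcases hp' with hp' | hp'
          · exact hp'
          · rw [hp', hlr']
        simp only [hlr', not_true_eq_false, if_false] at hpl' ⊢
        rw [hpl', single_self]
        have := plus (e' (Γ.circle a' (Γ.inner h false)))
        have := lt (e' (Γ.circle a' (Γ.inner h false)))
        congr 1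
        apply hatCoeff_two_eq_iff <;> omega
      · simp only [hlr', not_false_eq_true, if_true]
        have := plus (e' (Γ.circle a' (Γ.inner h false)))
        have := lt (e' (Γ.circle a' (Γ.inner h false)))
        have := plus (e' (Γ.circle a' (Γ.inner h true)))
        have := lt (e' (Γ.circle a' (Γ.inner h true)))
        rcases hp' with hp' | hp'
        · rw [hp', single_self, single_ne _ (Ne.symm hlr')]
          apply hatCoeff_two_eq_iff <;> omega
        · rw [hp', single_self, single_ne _ hlr']
          apply hatCoeff_two_eq_iff <;> omega
    -- Two circles never become two circles. This matters because the merge branch of `edgeCoeff`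
    -- reads only the exponent of `l'`.
    · have hlr' := Γ.circle_merge haa' ha ha' hlr
      have hpl' : Γ.circle a' p = Γ.circle a' (Γ.inner h true) := by
        rcases hp' with hp' | hp'
        · exact hp'
        · rw [hp', hlr']
      simp only [ne_eq, hlr, not_false_eq_true, if_true]
      rw [hpl', single_self]
      have := plus (e' (Γ.circle a' (Γ.inner h true)))
      have := lt (e' (Γ.circle a' (Γ.inner h true)))
      have := plus (e (Γ.circle a (Γ.inner h false)))
      have := lt (e (Γ.circle a (Γ.inner h false)))
      have := plus (e (Γ.circle a (Γ.inner h true)))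
      have := lt (e (Γ.circle a (Γ.inner h true)))
      rcases hp with hp | hp
      · rw [hp, single_self, single_ne _ (Ne.symm hlr)]
        apply hatCoeff_two_eq_iff <;> omega
      · rw [hp, single_self, single_ne _ hlr]
        apply hatCoeff_two_eq_iff <;> omega
  · have hp' : ¬ Γ.Through a' h p := fun h1 => hp ((Γ.through_congr haa' p).2 h1)
    simp only [Through, not_or] at hp hp'
    rw [single_ne _ (Ne.symm hp.1), single_ne _ (Ne.symm hp.2), single_ne _ (Ne.symm hp'.1),
      single_ne _ (Ne.symm hp'.2)]

open scoped Classical in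
theorem edgeMap_monomials (a a' : H → Bool) (h : H) (e : Γ.Circle a → Fin 2) :
    Γ.edgeMap 2 a a' h (Γ.monomials 2 a e) =
      ∑ e', Γ.edgeCoeff 2 a a' h e e' • Γ.monomials 2 a' e' := by
  rw [edgeMap, Module.Basis.constr_basis]

/-- This equivariance replaces any computation of the edge maps on colorings: joint eigenvectors of
the shifts go to joint eigenvectors with the same signs at all strand ends. -/
theorem shift_edgeMap {a a' : H → Bool} {h : H} (haa' : ∀ k, k ≠ h → a k = a' k)
    (ha : a h = false) (ha' : a' h = true) (p : Γ.StrandEnd) (x : Γ.StateSpace 2 a) :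
    Γ.shift a' (Γ.circle a' p) (Γ.edgeMap 2 a a' h x) =
      Γ.edgeMap 2 a a' h (Γ.shift a (Γ.circle a p) x) := by
  classical
  have : Γ.shift a' (Γ.circle a' p) ∘ₗ Γ.edgeMap 2 a a' h =
      Γ.edgeMap 2 a a' h ∘ₗ Γ.shift a (Γ.circle a p) := by
    refine (Γ.monomials 2 a).ext fun e => ?_
    simp only [LinearMap.comp_apply, edgeMap_monomials, shift_monomials, map_sum, map_smul]
    rw [← Equiv.sum_comp (Equiv.addRight (Pi.single (Γ.circle a' p) 1 : Γ.Circle a' → Fin 2))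
      (fun e' => Γ.edgeCoeff 2 a a' h _ e' • Γ.monomials 2 a' e')]
    refine Finset.sum_congr rfl fun e' _ => ?_
    rw [Equiv.coe_addRight, Γ.edgeCoeff_shift haa' ha ha']
  exact LinearMap.congr_fun this x

end OrientedRibbonGraph
end VertexHomology

/-! ### Edge maps in the basis of colorings -/

namespace VertexHomology
namespace OrientedRibbonGraph

variable {α β H : Type*} {G : Graph α β} (Γ : OrientedRibbonGraph G H)

/-- Nonnegativity excludes cancellation in `edgeMap_colorings_ne_zero`. -/
theorem hatCoeff_nonneg (n s t : ℕ) : ∃ r : ℝ, 0 ≤ r ∧ hatCoeff n s t = r := by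
  refine ⟨(if t = s then 1 else 0) + (if t + n = s then 1 else 0), ?_, ?_⟩
  · positivity
  · rw [hatCoeff]
    split_ifs <;> simp

theorem edgeCoeff_nonneg (n : ℕ) [NeZero n] (a a' : H → Bool) (h : H) (e : Γ.Circle a → Fin n)
    (e' : Γ.Circle a' → Fin n) : ∃ r : ℝ, 0 ≤ r ∧ Γ.edgeCoeff n a a' h e e' = r := by
  unfold edgeCoeff
  dsimp only
  split_ifs
  · exact hatCoeff_nonneg _ _ _
  · exact hatCoeff_nonneg _ _ _
  · obtain ⟨r, hr, h1⟩ := hatCoeff_nonneg n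
      ((e (Γ.circle a (Γ.inner h true)) : ℕ) + n / 2) (e' (Γ.circle a' (Γ.inner h true)))
    exact ⟨Real.sqrt n * r, by positivity, by rw [h1]; push_cast; rfl⟩
  · exact ⟨0, le_rfl, by simp⟩

variable [Finite H]

/-- The matrix entry of a linear map between state spaces with respect to the colorings. -/
noncomputable def entry {a a' : H → Bool} (f : Γ.StateSpace 2 a →ₗ[ℂ] Γ.StateSpace 2 a')
    (I : Γ.Circle a → Fin 2) (J : Γ.Circle a' → Fin 2) : ℂ :=
  (Γ.colorings 2 a').repr (f (Γ.colorings 2 a I)) J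

theorem hatCoeff_two_ne_zero {s t : ℕ} : hatCoeff 2 s t ≠ 0 ↔ t = s ∨ t + 2 = s := by
  unfold hatCoeff
  by_cases h1 : t = s
  · simp [h1]
  · by_cases h2 : t + 2 = s <;> simp [h1, h2]

open scoped Classical in
/-- Support of the coefficients of the monomial `1` in the images of the monomials, and the signs
of these monomials in a coloring. -/
theorem edgeCoeff_zero_right {a a' : H → Bool} {h : H} (haa' : ∀ k, k ≠ h → a k = a' k)
    (ha : a h = false) (ha' : a' h = true) (I : Γ.Circle a → Fin 2)
    (hI : Γ.circle a' (Γ.inner h true) = Γ.circle a' (Γ.inner h false) →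
      I (Γ.circle a (Γ.inner h true)) = I (Γ.circle a (Γ.inner h false))) :
    ∃ κ : ℂ, κ ≠ 0 ∧ (∀ e, Γ.edgeCoeff 2 a a' h e 0 ≠ 0 →
      (Γ.monomials 2 a).repr (Γ.colorings 2 a I) e = κ) ∧
      ∃ e, Γ.edgeCoeff 2 a a' h e 0 ≠ 0 := by
  set l := Γ.circle a (Γ.inner h true) with hl
  set r := Γ.circle a (Γ.inner h false) with hr
  have hsupp : ∀ e, Γ.edgeCoeff 2 a a' h e 0 ≠ 0 → ∀ c, c ≠ l → c ≠ r → e c = 0 := by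
    intro e he c hcl hcr
    obtain ⟨p, rfl⟩ := Γ.circle_surjective a c
    by_contra h0
    refine he (if_neg fun h1 => h0 (h1 p hcl hcr).symm)
  have hcf : ∀ e : Γ.Circle a → Fin 2, (∀ c, c ≠ l → c ≠ r → e c = 0) →
      Γ.edgeCoeff 2 a a' h e 0 = if l ≠ r then hatCoeff 2 ((e l : ℕ) + (e r : ℕ)) 0
        else if Γ.circle a' (Γ.inner h true) ≠ Γ.circle a' (Γ.inner h false) then
          hatCoeff 2 ((e l : ℕ) + 2) 0
        else (Real.sqrt 2 : ℂ) * hatCoeff 2 ((e l : ℕ) + 1) 0 := by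
    intro e he
    refine (if_pos fun p h1 h2 => (he _ h1 h2).symm).trans ?_
    simp only [Pi.zero_apply, Fin.val_zero, add_zero, Nat.cast_ofNat]
    rfl
  obtain ⟨K, hK, hval⟩ : ∃ K : ℂ, K ≠ 0 ∧ ∀ e : Γ.Circle a → Fin 2,
      (Γ.monomials 2 a).repr (Γ.colorings 2 a I) e =
        K * ∏ c, (-1) ^ ((e c : ℕ) * (I c : ℕ)) :=
    ⟨∏ _c : Γ.Circle a, (1 / 2 : ℂ), Finset.prod_ne_zero_iff.2 fun _ _ => by norm_num, fun e => by
      rw [monomials_repr_colorings, Finset.prod_mul_distrib]⟩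
  have lt : ∀ i : Fin 2, (i : ℕ) < 2 := fun i => i.2
  by_cases hlr : l = r
  · by_cases hlr' : Γ.circle a' (Γ.inner h true) = Γ.circle a' (Γ.inner h false)
    -- One circle becomes one circle: `e l + 1` has to be `0` or `2`, which forces `e l = 1` and
    -- produces the sign.
    · refine ⟨K * (-1) ^ (I l : ℕ),
        mul_ne_zero hK (by simp), fun e he => ?_, Pi.single l 1, ?_⟩
      · have hs := hsupp e he
        rw [hcf e hs, if_neg (by simpa using hlr), if_neg (by simpa using hlr')] at he
        have h1 := hatCoeff_two_ne_zero.1 (right_ne_zero_of_mul he)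
        have h2 : (e l : ℕ) = 1 := by omega
        rw [hval, Finset.prod_eq_single l, h2, one_mul]
        · intro c _ hc
          rw [hs c hc (hlr ▸ hc)]
          simp
        · simp
      · rw [hcf _ fun c hc _ => by simp [hc], if_neg (by simpa using hlr),
          if_neg (by simpa using hlr')]
        refine mul_ne_zero (by simp) (hatCoeff_two_ne_zero.2 ?_)
        simp
    · refine ⟨K, hK, fun e he => ?_, 0, ?_⟩
      · have hs := hsupp e he
        rw [hcf e hs, if_neg (by simpa using hlr), if_pos (by simpa using hlr')] at he
        have h1 := hatCoeff_two_ne_zero.1 he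
        have h2 : (e l : ℕ) = 0 := by omega
        rw [hval, Finset.prod_eq_one, mul_one]
        intro c _
        by_cases hc : c = l
        · simp [hc, h2]
        · simp [hs c hc (hlr ▸ hc)]
      · rw [hcf 0 fun c hc _ => rfl, if_neg (by simpa using hlr), if_pos (by simpa using hlr')]
        exact hatCoeff_two_ne_zero.2 (by simp)
  -- Two circles merge: the support is `e l = e r`, and the signs of the two factors cancel because
  -- `I` takes the same color on both circles.
  · have hIlr := hI (Γ.circle_merge haa' ha ha' hlr)
    refine ⟨K, hK, fun e he => ?_, 0, ?_⟩
    · have hs := hsupp e he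
      rw [hcf e hs, if_pos hlr] at he
      have h1 := hatCoeff_two_ne_zero.1 he
      have h2 : (e l : ℕ) = e r := by
        have := lt (e l)
        have := lt (e r)
        omega
      rw [hval, Finset.prod_eq_mul l r hlr, h2, hIlr, ← mul_pow]
      · simp
      · intro c _ hc
        simp [hs c hc.1 hc.2]
      · simp
      · simp
    · rw [hcf 0 fun c hc _ => rfl, if_pos hlr]
      exact hatCoeff_two_ne_zero.2 (by simp)

/-- It suffices to look at the coordinate of the monomial with all exponents zero. It is a sum of
nonnegative coefficients, not all zero, weighted by the coordinates of the coloring, and these equal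
one nonzero constant `κ` wherever the coefficient is nonzero. -/
theorem edgeMap_colorings_ne_zero {a a' : H → Bool} {h : H} (haa' : ∀ k, k ≠ h → a k = a' k)
    (ha : a h = false) (ha' : a' h = true) (I : Γ.Circle a → Fin 2)
    (hI : Γ.circle a' (Γ.inner h true) = Γ.circle a' (Γ.inner h false) →
      I (Γ.circle a (Γ.inner h true)) = I (Γ.circle a (Γ.inner h false))) :
    Γ.edgeMap 2 a a' h (Γ.colorings 2 a I) ≠ 0 := by
  classical
  intro h0
  obtain ⟨κ, hκ, h1, e₀, he₀⟩ := Γ.edgeCoeff_zero_right haa' ha ha' I hI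
  choose r hr hr' using fun e => Γ.edgeCoeff_nonneg 2 a a' h e 0
  have h2 := congrArg (fun x => (Γ.monomials 2 a').repr x 0) h0
  have h3 : Γ.colorings 2 a I =
      ∑ e, (Γ.monomials 2 a).repr (Γ.colorings 2 a I) e • Γ.monomials 2 a e :=
    ((Γ.monomials 2 a).sum_repr _).symm
  have h4 : ∀ e, (Γ.monomials 2 a').repr (Γ.edgeMap 2 a a' h (Γ.monomials 2 a e)) 0 = r e := by
    intro e
    rw [edgeMap_monomials, Module.Basis.repr_sum_self, ← hr']
  rw [h3] at h2
  simp only [map_sum, map_smul, Finsupp.coe_finsetSum, Finset.sum_apply, Finsupp.smul_apply, h4,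
    smul_eq_mul, map_zero, Finsupp.zero_apply] at h2
  have h5 : ∀ e, (Γ.monomials 2 a).repr (Γ.colorings 2 a I) e * (r e : ℂ) = κ * r e := by
    intro e
    by_cases hre : (r e : ℂ) = 0
    · rw [hre, mul_zero, mul_zero]
    · rw [h1 e (by rw [hr']; exact hre)]
  simp only [h5] at h2
  rw [← Finset.mul_sum] at h2
  have h6 := (mul_eq_zero.1 h2).resolve_left hκ
  have h7 : ∑ e, r e = 0 := by exact_mod_cast h6
  have h8 := (Finset.sum_eq_zero_iff_of_nonneg fun e _ => hr e).1 h7 e₀ (Finset.mem_univ _)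
  exact he₀ (by rw [hr', h8]; simp)

/-- A linear map between state spaces that takes each coloring to a nonzero multiple of the
agreeing coloring, or to zero if there is none. -/
def IsAgreeMap {a a' : H → Bool} (f : Γ.StateSpace 2 a →ₗ[ℂ] Γ.StateSpace 2 a') : Prop :=
  ∀ I J, Γ.entry f I J ≠ 0 ↔ Γ.Agree I J

/-- Comparing eigenvalues of the shifts at all strand ends leaves only the agreeing coloring as a
possible term of the image. Since the image is nonzero when an agreeing coloring exists, that term
must occur. -/
theorem isAgreeMap_edgeMap {a a' : H → Bool} {h : H} (haa' : ∀ k, k ≠ h → a k = a' k)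
    (ha : a h = false) (ha' : a' h = true) : Γ.IsAgreeMap (Γ.edgeMap 2 a a' h) := by
  have key : ∀ I J, Γ.entry (Γ.edgeMap 2 a a' h) I J ≠ 0 → Γ.Agree I J := by
    intro I J hIJ p
    have h1 := congrArg (fun x => (Γ.colorings 2 a').repr x J)
      (Γ.shift_edgeMap haa' ha ha' p (Γ.colorings 2 a I))
    rw [colorings_repr_shift, shift_colorings, map_smul, map_smul, Finsupp.smul_apply,
      smul_eq_mul] at h1
    exact colorSign_injective (mul_right_cancel₀ hIJ h1).symm
  refine fun I J => ⟨key I J, fun hIJ => ?_⟩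
  have h1 : Γ.edgeMap 2 a a' h (Γ.colorings 2 a I) ≠ 0 :=
    Γ.edgeMap_colorings_ne_zero haa' ha ha' I fun hh => by rw [hIJ, hIJ, hh]
  have h2 : ∃ K, Γ.entry (Γ.edgeMap 2 a a' h) I K ≠ 0 := by
    by_contra! h0
    exact h1 ((Γ.colorings 2 a').ext_elem fun K => by simpa [entry] using h0 K)
  obtain ⟨K, hK⟩ := h2
  rwa [hIJ.unique (key I K hK)]

theorem entry_comp {a b c : H → Bool} (f : Γ.StateSpace 2 a →ₗ[ℂ] Γ.StateSpace 2 b)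
    (g : Γ.StateSpace 2 b →ₗ[ℂ] Γ.StateSpace 2 c) (I : Γ.Circle a → Fin 2)
    (K : Γ.Circle c → Fin 2) [Fintype (Γ.Circle b → Fin 2)] :
    Γ.entry (g ∘ₗ f) I K = ∑ J, Γ.entry f I J * Γ.entry g J K := by
  unfold entry
  conv_lhs => rw [LinearMap.comp_apply, ← (Γ.colorings 2 b).sum_repr (f (Γ.colorings 2 a I))]
  simp only [map_sum, map_smul, Finsupp.coe_finsetSum, Finset.sum_apply, Finsupp.smul_apply,
    smul_eq_mul]

variable {Γ}

/-- The coloring of the middle state that agrees with `I` is unique, so at most one term of the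
matrix product survives and nothing can cancel; `hb` ensures that this coloring exists. -/
theorem IsAgreeMap.comp {a b c : H → Bool} {f : Γ.StateSpace 2 a →ₗ[ℂ] Γ.StateSpace 2 b}
    {g : Γ.StateSpace 2 b →ₗ[ℂ] Γ.StateSpace 2 c} (hf : Γ.IsAgreeMap f) (hg : Γ.IsAgreeMap g)
    (hb : ∀ k, b k = a k ∨ b k = c k) : Γ.IsAgreeMap (g ∘ₗ f) := by
  classical
  intro I K
  rw [entry_comp]
  constructor
  · intro h
    obtain ⟨J, -, hJ⟩ := Finset.exists_ne_zero_of_sum_ne_zero h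
    exact ((hf I J).1 (left_ne_zero_of_mul hJ)).trans ((hg J K).1 (right_ne_zero_of_mul hJ))
  · intro h
    obtain ⟨J, hJ⟩ := h.exists_between hb
    rw [Finset.sum_eq_single J]
    · exact mul_ne_zero ((hf I J).2 hJ) ((hg J K).2 (hJ.symm.trans h))
    · intro J' _ hJ'
      by_contra h0
      exact hJ' (((hf I J').1 (left_ne_zero_of_mul h0)).unique hJ)
    · simp

/-- Agreement is a partial bijection between colorings, so the nonzero images of distinct colorings
are multiples of distinct basis vectors. -/
theorem IsAgreeMap.apply_eq_zero_iff {a b : H → Bool}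
    {f : Γ.StateSpace 2 a →ₗ[ℂ] Γ.StateSpace 2 b} (hf : Γ.IsAgreeMap f) (x : Γ.StateSpace 2 a) :
    f x = 0 ↔ ∀ I, (∃ J : Γ.Circle b → Fin 2, Γ.Agree I J) →
      (Γ.colorings 2 a).repr x I = 0 := by
  classical
  have h1 : ∀ J, (Γ.colorings 2 b).repr (f x) J =
      ∑ I, (Γ.colorings 2 a).repr x I * Γ.entry f I J := by
    intro J
    conv_lhs => rw [← (Γ.colorings 2 a).sum_repr x]
    simp only [map_sum, map_smul, Finsupp.coe_finsetSum, Finset.sum_apply, Finsupp.smul_apply,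
      smul_eq_mul, entry]
  have h2 : ∀ I J, Γ.Agree I J → (Γ.colorings 2 b).repr (f x) J =
      (Γ.colorings 2 a).repr x I * Γ.entry f I J := by
    intro I J hIJ
    rw [h1, Finset.sum_eq_single I]
    · intro I' _ hI'
      rw [mul_eq_zero]
      right
      by_contra h0
      exact hI' (((hf I' J).1 h0).symm.unique hIJ.symm)
    · simp
  constructor
  · rintro h I ⟨J, hIJ⟩
    have h3 := h2 I J hIJ
    rw [h, map_zero, Finsupp.zero_apply] at h3
    exact (mul_eq_zero.1 h3.symm).resolve_right ((hf I J).2 hIJ)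
  · intro h
    refine (Γ.colorings 2 b).ext_elem fun J => ?_
    rw [h1, map_zero, Finsupp.zero_apply]
    refine Finset.sum_eq_zero fun I _ => ?_
    by_cases h3 : Γ.entry f I J = 0
    · rw [h3, mul_zero]
    · rw [h I ⟨J, (hf I J).1 h3⟩, zero_mul]

theorem entry_adjoint {a b : H → Bool} (f : Γ.StateSpace 2 a →ₗ[ℂ] Γ.StateSpace 2 b)
    (I : Γ.Circle a → Fin 2) (J : Γ.Circle b → Fin 2) :
    Γ.entry (Γ.adjoint 2 f) J I = starRingEnd ℂ (Γ.entry f I J) := by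
  classical
  rw [entry, OrientedRibbonGraph.adjoint, Matrix.toLin_self, Module.Basis.repr_sum_self,
    Matrix.conjTranspose_apply, LinearMap.toMatrix_apply']
  rfl

theorem IsAgreeMap.adjoint {a b : H → Bool} {f : Γ.StateSpace 2 a →ₗ[ℂ] Γ.StateSpace 2 b}
    (hf : Γ.IsAgreeMap f) : Γ.IsAgreeMap (Γ.adjoint 2 f) := by
  intro J I
  rw [entry_adjoint, map_ne_zero, hf]
  exact ⟨Agree.symm, Agree.symm⟩

end OrientedRibbonGraph
end VertexHomology

namespace VertexHomology
theorem minimalPeriod_eq_ncard_sameCycle {X : Type*} [Finite X] (φ : Equiv.Perm X) (x : X) :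
    Function.minimalPeriod φ x = {y | φ.SameCycle x y}.ncard := by
  have := Fintype.ofFinite (MulAction.orbit (Subgroup.zpowers φ) x)
  have h1 := MulAction.minimalPeriod_eq_card (a := φ) (b := x)
  rw [← Nat.card_eq_fintype_card, Nat.card_coe_set_eq] at h1
  refine Eq.trans h1 (congrArg Set.ncard ?_)
  ext y
  constructor
  · rintro ⟨⟨_, i, rfl⟩, rfl⟩
    exact ⟨i, rfl⟩
  · rintro ⟨i, rfl⟩
    exact ⟨⟨_, i, rfl⟩, rfl⟩

namespace OrientedRibbonGraph

variable {α β H : Type*} {G : Graph α β} (Γ : OrientedRibbonGraph G H)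

/-! ### Half-edges and degrees -/

theorem edge_opp (h : H) : Γ.edge (Γ.opp h) = Γ.edge h :=
  ((Γ.edge_eq_iff h (Γ.opp h)).2 (Or.inr rfl)).symm

theorem exists_edge_eq {e : β} (he : e ∈ E(G)) : ∃ h, (Γ.edge h : β) = e := by
  obtain ⟨h, hh⟩ := Γ.edge_surjective ⟨e, he⟩
  exact ⟨h, by rw [hh]⟩

theorem edge_val_eq_iff (h h' : H) : (Γ.edge h : β) = Γ.edge h' ↔ h' = h ∨ h' = Γ.opp h := by
  rw [← Γ.edge_eq_iff, Subtype.ext_iff]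

theorem inc_iff {e : β} {x : α} :
    G.Inc e x ↔ ∃ h, (Γ.edge h : β) = e ∧ (Γ.vert h : α) = x := by
  constructor
  · intro he
    obtain ⟨h, rfl⟩ := Γ.exists_edge_eq he.edge_mem
    rcases he.eq_or_eq_of_isLink (Γ.isLink h) with rfl | rfl
    · exact ⟨h, rfl, rfl⟩
    · exact ⟨Γ.opp h, by rw [edge_opp], rfl⟩
  · rintro ⟨h, rfl, rfl⟩
    exact (Γ.isLink h).inc_left

theorem isLoopAt_iff {h : H} {x : α} :
    G.IsLoopAt (Γ.edge h) x ↔ (Γ.vert h : α) = x ∧ (Γ.vert (Γ.opp h) : α) = x := by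
  rw [← Graph.isLink_self_iff, (Γ.isLink h).isLink_iff]
  tauto

theorem isNonloopAt_iff {h : H} {x : α} :
    G.IsNonloopAt (Γ.edge h) x ↔ (Γ.vert h : α) = x ∧ (Γ.vert (Γ.opp h) : α) ≠ x ∨
      (Γ.vert (Γ.opp h) : α) = x ∧ (Γ.vert h : α) ≠ x := by
  constructor
  · rintro ⟨y, hy, h1⟩
    rcases (Γ.isLink h).isLink_iff.1 h1 with ⟨h2, h3⟩ | ⟨h2, h3⟩
    · exact Or.inl ⟨h2, h3 ▸ hy⟩
    · exact Or.inr ⟨h3, h2 ▸ hy⟩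
  · rintro (⟨h1, h2⟩ | ⟨h1, h2⟩)
    · exact ⟨_, h2, h1 ▸ Γ.isLink h⟩
    · exact ⟨_, h2, h1 ▸ (Γ.isLink h).symm⟩

theorem ncard_edge_mem [Finite H] (F : Set β) (hF : F ⊆ E(G)) :
    {h | (Γ.edge h : β) ∈ F}.ncard = 2 * F.ncard := by
  have : Nonempty (F → H) := ⟨fun e => (Γ.exists_edge_eq (hF e.2)).choose⟩
  choose s hs using fun e : F => Γ.exists_edge_eq (hF e.2)
  have hinj : Function.Injective s := fun e f hef => Subtype.ext (by rw [← hs e, ← hs f, hef])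
  have hopp : Function.Injective Γ.opp := fun x y hxy => by rw [← Γ.opp_opp x, hxy, Γ.opp_opp]
  have h1 : {h | (Γ.edge h : β) ∈ F} = Set.range s ∪ Set.range (Γ.opp ∘ s) := by
    ext h
    constructor
    · intro hh
      rcases (Γ.edge_val_eq_iff (s ⟨_, hh⟩) h).1 (hs ⟨_, hh⟩) with h2 | h2
      · exact Or.inl ⟨_, h2.symm⟩
      · exact Or.inr ⟨_, h2.symm⟩
    · rintro (⟨e, rfl⟩ | ⟨e, rfl⟩)
      · rw [Set.mem_ofPred_eq, hs]
        exact e.2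
      · rw [Set.mem_ofPred_eq, Function.comp_apply, edge_opp, hs]
        exact e.2
  have h2 : Disjoint (Set.range s) (Set.range (Γ.opp ∘ s)) := by
    rw [Set.disjoint_left]
    rintro _ ⟨e, rfl⟩ ⟨f, hf⟩
    rw [Function.comp_apply] at hf
    have h3 : f = e := Subtype.ext (by rw [← hs e, ← hf, edge_opp, hs])
    rw [h3] at hf
    exact Γ.opp_ne _ hf
  rw [h1, Set.ncard_union_eq h2, ← Set.image_univ, ← Set.image_univ,
    Set.ncard_image_of_injective _ hinj, Set.ncard_image_of_injective _ (hopp.comp hinj),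
    Set.ncard_univ, Nat.card_coe_set_eq]
  ring

/-- The degree in a subgraph with edge set `F` is the number of half-edges on edges in `F`. -/
theorem degree_eq_ncard [Finite H] {G' : Graph α β} {F : Set β}
    (hG' : ∀ e x y, G'.IsLink e x y ↔ G.IsLink e x y ∧ e ∈ F) (x : α) :
    degree G' x = {h | (Γ.vert h : α) = x ∧ (Γ.edge h : β) ∈ F}.ncard := by
  have hloop : {e | G'.IsLoopAt e x} = {e | G.IsLoopAt e x ∧ e ∈ F} := by
    ext e
    exact hG' e x x
  have hnon : {e | G'.IsNonloopAt e x} = {e | G.IsNonloopAt e x ∧ e ∈ F} := by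
    ext e
    simp only [Graph.IsNonloopAt, hG', Set.mem_ofPred_eq]
    constructor
    · rintro ⟨y, h1, h2, h3⟩
      exact ⟨⟨y, h1, h2⟩, h3⟩
    · rintro ⟨⟨y, h1, h2⟩, h3⟩
      exact ⟨y, h1, h2, h3⟩
  -- A non-loop edge at `x` has one half at `x`, a loop has both; this matches the factor `2` in
  -- `degree`.
  have h1 : {h | (Γ.vert h : α) = x ∧ (Γ.edge h : β) ∈ F} =
      {h | (Γ.vert h : α) = x ∧ (Γ.vert (Γ.opp h) : α) ≠ x ∧ (Γ.edge h : β) ∈ F} ∪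
        {h | (Γ.edge h : β) ∈ {e | G.IsLoopAt e x ∧ e ∈ F}} := by
    ext h
    simp only [Set.mem_ofPred_eq, Set.mem_union, isLoopAt_iff]
    tauto
  have h2 : Disjoint
      {h | (Γ.vert h : α) = x ∧ (Γ.vert (Γ.opp h) : α) ≠ x ∧ (Γ.edge h : β) ∈ F}
      {h | (Γ.edge h : β) ∈ {e | G.IsLoopAt e x ∧ e ∈ F}} := by
    rw [Set.disjoint_left]
    rintro h ⟨-, hh, -⟩ ⟨hl, -⟩
    exact hh (Γ.isLoopAt_iff.1 hl).2
  have h3 : {e | G.IsNonloopAt e x ∧ e ∈ F} = (fun h => (Γ.edge h : β)) ''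
      {h | (Γ.vert h : α) = x ∧ (Γ.vert (Γ.opp h) : α) ≠ x ∧ (Γ.edge h : β) ∈ F} := by
    ext e
    constructor
    · rintro ⟨he, heF⟩
      obtain ⟨h, rfl⟩ := Γ.exists_edge_eq he.edge_mem
      rcases Γ.isNonloopAt_iff.1 he with hh | hh
      · exact ⟨h, ⟨hh.1, hh.2, heF⟩, rfl⟩
      · refine ⟨Γ.opp h, ⟨hh.1, ?_, ?_⟩, ?_⟩
        · rw [Γ.opp_opp]; exact hh.2
        · rw [edge_opp]; exact heF
        · simp only [edge_opp]
    · rintro ⟨h, ⟨hh1, hh2, hh3⟩, rfl⟩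
      exact ⟨Γ.isNonloopAt_iff.2 (Or.inl ⟨hh1, hh2⟩), hh3⟩
  have h4 : Set.InjOn (fun h => (Γ.edge h : β))
      {h | (Γ.vert h : α) = x ∧ (Γ.vert (Γ.opp h) : α) ≠ x ∧ (Γ.edge h : β) ∈ F} := by
    rintro h ⟨-, hh, -⟩ k ⟨hk, -, -⟩ hhk
    rcases (Γ.edge_val_eq_iff h k).1 hhk with h5 | h5
    · exact h5.symm
    · exact absurd (h5 ▸ hk) hh
  rw [degree, hloop, hnon, h1, Set.ncard_union_eq h2, Γ.ncard_edge_mem, h3,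
    h4.ncard_image]
  exact fun e he => he.1.edge_mem

theorem ncard_vert_eq [Finite H] (htri : IsTrivalent G) (v : V(G)) :
    {h | Γ.vert h = v}.ncard = 3 := by
  rw [← htri v v.2, Γ.degree_eq_ncard (F := Set.univ) (by simp)]
  simp [Subtype.ext_iff]

theorem vert_rot (h : H) : Γ.vert (Γ.rot h) = Γ.vert h :=
  ((Γ.vert_eq_iff h _).2 ⟨1, by simp⟩).symm

theorem exists_vert_eq [Finite H] (htri : IsTrivalent G) (v : V(G)) : ∃ h, Γ.vert h = v := by
  have := Γ.ncard_vert_eq htri v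
  exact Set.nonempty_of_ncard_ne_zero (s := {h | Γ.vert h = v}) (by omega)

section Trivalent

variable [Finite H] (htri : IsTrivalent G)
include htri

theorem minimalPeriod_rot (h : H) : Function.minimalPeriod Γ.rot h = 3 := by
  rw [minimalPeriod_eq_ncard_sameCycle, ← Γ.ncard_vert_eq htri (Γ.vert h)]
  congr 1
  ext k
  rw [Set.mem_ofPred_eq, Set.mem_ofPred_eq, ← Γ.vert_eq_iff, eq_comm]

theorem rot_rot_rot (h : H) : Γ.rot (Γ.rot (Γ.rot h)) = h := by
  have := Function.isPeriodicPt_minimalPeriod Γ.rot h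
  rw [Γ.minimalPeriod_rot htri] at this
  exact this

theorem rot_ne (h : H) : Γ.rot h ≠ h := by
  intro h1
  have h2 : Function.IsPeriodicPt Γ.rot 1 h := h1
  have := h2.minimalPeriod_le one_pos
  rw [Γ.minimalPeriod_rot htri] at this
  omega

theorem rot_rot_ne (h : H) : Γ.rot (Γ.rot h) ≠ h := by
  intro h1
  have h2 : Function.IsPeriodicPt Γ.rot 2 h := h1
  have := h2.minimalPeriod_le two_pos
  rw [Γ.minimalPeriod_rot htri] at this
  omega

theorem vert_eq_iff_rot (h k : H) :
    Γ.vert k = Γ.vert h ↔ k = h ∨ k = Γ.rot h ∨ k = Γ.rot (Γ.rot h) := by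
  have h1 : ({h, Γ.rot h, Γ.rot (Γ.rot h)} : Set H) = {k | Γ.vert k = Γ.vert h} := by
    refine Set.eq_of_subset_of_ncard_le ?_ ?_
    · rintro k (rfl | rfl | rfl) <;> simp [vert_rot]
    · rw [Γ.ncard_vert_eq htri, Set.ncard_insert_of_notMem, Set.ncard_pair]
      · exact (Γ.rot_ne htri _).symm
      · simp only [Set.mem_insert_iff, Set.mem_singleton_iff, not_or]
        exact ⟨(Γ.rot_ne htri _).symm, (Γ.rot_rot_ne htri _).symm⟩
  have h2 := Set.ext_iff.1 h1 k
  simpa using h2.symm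

/-! ### The local differentials -/

/-- The three half-edges at the vertex are distinct, even if two of them form a loop, so each step
changes a smoothing from `0` to `1`. Every intermediate state coincides at each half-edge with one
of the two end states, as `IsAgreeMap.comp` requires. -/
theorem isAgreeMap_pathMap {ν ν' : V(G) → Bool} (h : H) (hν : ν (Γ.vert h) = false)
    (hν' : ν' (Γ.vert h) = true) (hνν' : ∀ w, w ≠ Γ.vert h → ν w = ν' w) :
    Γ.IsAgreeMap (Γ.pathMap 2 ν ν' h) := by
  classical
  have h1 := Γ.rot_ne htri h
  have h2 := Γ.rot_ne htri (Γ.rot h)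
  have h3 := Γ.rot_rot_ne htri h
  have hv := Γ.vert_eq_iff_rot htri h
  have hout : ∀ k, Γ.vert k ≠ Γ.vert h → Γ.ofVertexState ν k = Γ.ofVertexState ν' k :=
    fun k hk => hνν' _ hk
  have hin : ∀ k, Γ.vert k = Γ.vert h →
      Γ.ofVertexState ν k = false ∧ Γ.ofVertexState ν' k = true := fun k hk => by
    simp only [ofVertexState, hk, hν, hν', and_self]
  have e0 := hin h rfl
  have e1 := hin (Γ.rot h) (Γ.vert_rot h)
  have e2 := hin (Γ.rot (Γ.rot h)) (by rw [vert_rot, vert_rot])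
  unfold pathMap
  dsimp only
  generalize Γ.rot (Γ.rot h) = k₂ at *
  generalize Γ.rot h = k₁ at *
  refine IsAgreeMap.comp (IsAgreeMap.comp (Γ.isAgreeMap_edgeMap ?_ ?_ ?_)
    (Γ.isAgreeMap_edgeMap ?_ ?_ ?_) ?_) (Γ.isAgreeMap_edgeMap ?_ ?_ ?_) ?_
  · intro k hk
    rw [Function.update_of_ne hk]
  · exact e0.1
  · rw [Function.update_self]
  · intro k hk
    rw [Function.update_of_ne hk]
  · rw [Function.update_of_ne h1, e1.1]
  · rw [Function.update_self]
  · intro k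
    by_cases hk : k = k₁
    · left
      rw [hk, Function.update_of_ne h1]
    · right
      rw [Function.update_of_ne hk]
  · intro k hk
    by_cases hk1 : k = k₁
    · rw [hk1, Function.update_self, e1.2]
    · rw [Function.update_of_ne hk1]
      by_cases hk0 : k = h
      · rw [hk0, Function.update_self, e0.2]
      · rw [Function.update_of_ne hk0, hout]
        rw [Ne, hv]
        tauto
  · rw [Function.update_of_ne h2, Function.update_of_ne h3, e2.1]
  · exact e2.2
  · intro k
    by_cases hk1 : k = k₁
    · right
      rw [hk1, Function.update_self, e1.2]
    · rw [Function.update_of_ne hk1]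
      by_cases hk0 : k = h
      · right
        rw [hk0, Function.update_self, e0.2]
      · left
        rw [Function.update_of_ne hk0]

theorem isAgreeMap_localDifferential {ν ν' : V(G) → Bool} (v : V(G)) (hν : ν v = false)
    (hν' : ν' v = true) (hνν' : ∀ w, w ≠ v → ν w = ν' w) :
    Γ.IsAgreeMap (Γ.localDifferential 2 ν ν' v) := by
  have hv := Γ.exists_vert_eq htri v
  have h1 := hv.choose_spec
  rw [localDifferential, dif_pos hv]
  apply Γ.isAgreeMap_pathMap htri
  all_goals rwa [h1]

end Trivalent

end OrientedRibbonGraph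
end VertexHomology

namespace VertexHomology
namespace OrientedRibbonGraph

variable {α β H : Type*} {G : Graph α β} (Γ : OrientedRibbonGraph G H)

/-! ### The harmonic spaces -/

/-- Exchanging the smoothings at `h` swaps which outer end is joined to which inner end. A coloring
survives this exactly when both strands at `h` have the same color. -/
theorem exists_agree_iff {a a' : H → Bool} {X : Type*} (I : Γ.Circle a → X) :
    (∃ J : Γ.Circle a' → X, Γ.Agree I J) ↔
      ∀ h, a h ≠ a' h → I (Γ.circle a (Γ.inner h true)) = I (Γ.circle a (Γ.inner h false)) := by
  have hpar : ∀ {b : H → Bool} {h : H} (s : Bool), b h = false →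
      Γ.circle b (Γ.inner h s) = Γ.circle b (Γ.outer h s) :=
    fun s hb => Γ.circle_eq_of_arc (Arc.parallel _ s hb)
  have hcro : ∀ {b : H → Bool} {h : H} (s : Bool), b h = true →
      Γ.circle b (Γ.inner h s) = Γ.circle b (Γ.outer h !s) :=
    fun s hb => Γ.circle_eq_of_arc (Arc.crossing _ s hb)
  constructor
  · rintro ⟨J, hJ⟩ h hne
    cases ha : a h <;> cases ha' : a' h
    · exact absurd (ha.trans ha'.symm) hne
    · rw [hpar _ ha, hJ, hJ, hcro _ ha', Bool.not_false]
    · rw [hcro _ ha, hJ, hJ, hpar _ ha', Bool.not_true]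
    · exact absurd (ha.trans ha'.symm) hne
  · intro hI
    have hout : ∀ h, a h ≠ a' h → ∀ s s', I (Γ.circle a (Γ.inner h s)) =
        I (Γ.circle a (Γ.outer h s')) := by
      intro h hne s s'
      have h1 := hI h hne
      cases ha : a h
      · rw [← hpar _ ha]
        cases s <;> cases s' <;> first | rfl | exact h1 | exact h1.symm
      · rw [← Bool.not_not s', ← hcro _ ha]
        cases s <;> cases s' <;> first | rfl | exact h1 | exact h1.symm
    refine ⟨Quot.lift (fun p => I (Γ.circle a p)) ?_, fun p => rfl⟩
    intro p q hpq
    cases hpq with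
    | corner k => rw [Γ.circle_eq_of_arc (Arc.corner k)]
    | bubble k => rw [Γ.circle_eq_of_arc (Arc.bubble k)]
    | parallel k s hk =>
      by_cases hne : a k = a' k
      · rw [Γ.circle_eq_of_arc (Arc.parallel k s (hne.trans hk))]
      · exact hout k hne _ _
    | crossing k s hk =>
      by_cases hne : a k = a' k
      · rw [Γ.circle_eq_of_arc (Arc.crossing k s (hne.trans hk))]
      · exact hout k hne _ _

/-- The colorings of the circles of a state in which the corners at each vertex do not all have
the same color. -/
def IsProper {a : H → Bool} {X : Type*} (I : Γ.Circle a → X) : Prop :=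
  ∀ v, ∃ h, Γ.vert h = v ∧
    I (Γ.circle a (Γ.inner h true)) ≠ I (Γ.circle a (Γ.inner h false))

variable [Finite H] (htri : IsTrivalent G)
include htri

-- At each vertex `v` either a differential leaves `ν` or an adjoint does, depending on `ν v`. Both
-- are agree maps to the state with `ν v` flipped, so they impose the same condition: the
-- coefficients vanish on the colorings whose corners at `v` all have one color.
set_option maxRecDepth 4000 in
theorem mem_harmonicSpace_iff (ν : V(G) → Bool) (x : Γ.VertexSpace 2 ν) :
    x ∈ Γ.harmonicSpace 2 ν ↔
      ∀ I, ¬ Γ.IsProper I → (Γ.colorings 2 (Γ.ofVertexState ν)).repr x I = 0 := by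
  classical
  have hex : ∀ (ν' : V(G) → Bool) (v : V(G)), ν v ≠ ν' v → (∀ w, w ≠ v → ν w = ν' w) →
      ∀ I : Γ.Circle (Γ.ofVertexState ν) → Fin 2,
      (∃ J : Γ.Circle (Γ.ofVertexState ν') → Fin 2, Γ.Agree I J) ↔ ∀ h, Γ.vert h = v →
        I (Γ.circle _ (Γ.inner h true)) = I (Γ.circle _ (Γ.inner h false)) := by
    intro ν' v hv hw I
    rw [exists_agree_iff]
    refine forall_congr' fun h => imp_congr_left ?_
    constructor
    · intro hne
      by_contra hhv
      exact hne (hw _ hhv)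
    · rintro rfl
      exact hv
  have key : ∀ v, (∀ I, (∀ h, Γ.vert h = v →
        I (Γ.circle _ (Γ.inner h true)) = I (Γ.circle _ (Γ.inner h false))) →
      (Γ.colorings 2 (Γ.ofVertexState ν)).repr x I = 0) ↔
      (∀ hv : ν v = false, Γ.stateDifferential 2 ν x ⟨v, hv⟩ = 0) ∧
        ∀ hv : ν v = true, Γ.stateAdjoint 2 ν x ⟨v, hv⟩ = 0 := by
    intro v
    rcases Bool.eq_false_or_eq_true (ν v) with hv | hv
    swap
    · have hne : ν v ≠ Function.update ν v true v := by simp [hv]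
      have hw : ∀ w, w ≠ v → ν w = Function.update ν v true w :=
        fun w hw => by rw [Function.update_of_ne hw]
      have h1 := (Γ.isAgreeMap_localDifferential htri v hv (by simp) hw).apply_eq_zero_iff x
      simp only [hex _ v hne hw] at h1
      rw [← h1]
      exact ⟨fun h => ⟨fun _ => h, fun h2 => absurd (hv.symm.trans h2) (by simp)⟩,
        fun h => h.1 hv⟩
    · have hne : ν v ≠ Function.update ν v false v := by simp [hv]
      have hw : ∀ w, w ≠ v → ν w = Function.update ν v false w :=
        fun w hw => by rw [Function.update_of_ne hw]
      have h1 := (Γ.isAgreeMap_localDifferential htri v (by simp) hv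
        fun w h => (hw w h).symm).adjoint.apply_eq_zero_iff x
      simp only [hex _ v hne hw] at h1
      rw [← h1]
      exact ⟨fun h => ⟨fun h2 => absurd (hv.symm.trans h2) (by simp), fun _ => h⟩,
        fun h => h.2 hv⟩
  have hdiff : Γ.stateDifferential 2 ν x = 0 ↔
      ∀ v hv, Γ.stateDifferential 2 ν x ⟨v, hv⟩ = 0 :=
    ⟨fun h v hv => by rw [h, Pi.zero_apply],
      fun h => funext fun v => by rw [Pi.zero_apply]; exact h v.1 v.2⟩
  have hadj : Γ.stateAdjoint 2 ν x = 0 ↔ ∀ v hv, Γ.stateAdjoint 2 ν x ⟨v, hv⟩ = 0 :=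
    ⟨fun h v hv => by rw [h, Pi.zero_apply],
      fun h => funext fun v => by rw [Pi.zero_apply]; exact h v.1 v.2⟩
  rw [harmonicSpace, Submodule.mem_inf, LinearMap.mem_ker, LinearMap.mem_ker, hdiff, hadj,
    ← forall_and, ← forall_congr' key]
  constructor
  · intro h I hI
    simp only [IsProper, not_forall, not_exists, not_and, not_not] at hI
    obtain ⟨v, hv⟩ := hI
    exact h v I hv
  · intro h v I hI
    refine h I fun hp => ?_
    obtain ⟨k, hk, hne⟩ := hp v
    exact hne (hI k hk)

theorem finrank_harmonicSpace (ν : V(G) → Bool) :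
    Module.finrank ℂ (Γ.harmonicSpace 2 ν) =
      Nat.card {I : Γ.Circle (Γ.ofVertexState ν) → Fin 2 // Γ.IsProper I} := by
  classical
  have h1 : Γ.harmonicSpace 2 ν = (Finsupp.supported ℂ ℂ
      {I : Γ.Circle (Γ.ofVertexState ν) → Fin 2 | Γ.IsProper I}).comap
      (Γ.colorings 2 (Γ.ofVertexState ν)).repr.toLinearMap := by
    ext x
    rw [Γ.mem_harmonicSpace_iff htri, Submodule.mem_comap, Finsupp.mem_supported']
    rfl
  rw [h1, LinearEquiv.finrank_eq (LinearEquiv.ofSubmodule' (Γ.colorings 2 (Γ.ofVertexState ν)).repr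
    _), LinearEquiv.finrank_eq (Finsupp.supportedEquivFinsupp _), Module.finrank_finsupp_self,
    ← Nat.card_eq_fintype_card]
  rfl

theorem totalMatchingPolynomial_eq_card [Finite V(G)] :
    Γ.totalMatchingPolynomial 2 = Nat.card
      (Σ ν : V(G) → Bool, {I : Γ.Circle (Γ.ofVertexState ν) → Fin 2 // Γ.IsProper I}) := by
  classical
  have := Fintype.ofFinite (V(G) → Bool)
  rw [Nat.card_sigma, totalMatchingPolynomial, totalMatchingPolynomial₂, finsum_eq_sum_of_fintype,
    Polynomial.eval_finsetSum]
  refine Finset.sum_congr rfl fun ν _ => ?_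
  rw [Polynomial.eval_monomial, one_pow, mul_one, Γ.finrank_harmonicSpace htri]

end OrientedRibbonGraph
end VertexHomology

namespace VertexHomology

/-! ### Pairs of involutions -/

section Involutions

/-- One step along one of two maps. -/
def Linked {X : Type*} (τ σ : X → X) (x y : X) : Prop := y = τ x ∨ y = σ x

variable {X : Type*} {τ σ : X → X}

theorem mk_linked_left (x : X) : Quot.mk (Linked τ σ) (τ x) = Quot.mk (Linked τ σ) x :=
  (Quot.sound (r := Linked τ σ) (Or.inl rfl)).symm

theorem mk_linked_right (x : X) : Quot.mk (Linked τ σ) (σ x) = Quot.mk (Linked τ σ) x :=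
  (Quot.sound (r := Linked τ σ) (Or.inr rfl)).symm

/-- The functions with prescribed change along `τ` and `σ`. -/
abbrev Labeling (τ σ : X → X) (s t : Bool) : Type _ :=
  {g : X → Bool // (∀ x, g (τ x) = xor (g x) s) ∧ ∀ x, g (σ x) = xor (g x) t}

/-- Labelings form a torsor under the Boolean functions on the classes of `Linked τ σ`: the `xor` of
two labelings is constant on classes. -/
theorem card_labeling_of_nonempty [Finite X] {s t : Bool} (g₀ : Labeling τ σ s t) :
    Nat.card (Labeling τ σ s t) = 2 ^ Nat.card (Quot (Linked τ σ)) := by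
  have e : Labeling τ σ s t ≃ (Quot (Linked τ σ) → Bool) :=
    { toFun := fun g => Quot.lift (fun x => xor (g.1 x) (g₀.1 x)) (by
        rintro x y (rfl | rfl)
        · rw [g.2.1, g₀.2.1]
          cases g.1 x <;> cases g₀.1 x <;> cases s <;> rfl
        · rw [g.2.2, g₀.2.2]
          cases g.1 x <;> cases g₀.1 x <;> cases t <;> rfl)
      invFun := fun u => ⟨fun x => xor (u (Quot.mk _ x)) (g₀.1 x), fun x => by
          dsimp only
          rw [g₀.2.1, mk_linked_left, Bool.xor_assoc], fun x => by
          dsimp only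
          rw [g₀.2.2, mk_linked_right, Bool.xor_assoc]⟩
      left_inv := fun g => Subtype.ext (funext fun x => by simp)
      right_inv := fun u => funext fun q => by
        induction q using Quot.ind
        simp }
  rw [Nat.card_congr e, Nat.card_fun, Nat.card_eq_fintype_card, Fintype.card_bool]

theorem card_labeling_le [Finite X] (s t : Bool) :
    Nat.card (Labeling τ σ s t) ≤ 2 ^ Nat.card (Quot (Linked τ σ)) := by
  rcases isEmpty_or_nonempty (Labeling τ σ s t) with h | ⟨⟨g₀⟩⟩
  · simp
  · exact (card_labeling_of_nonempty g₀).le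

variable (hτ : Function.Involutive τ) (hσ : Function.Involutive σ)

/-- The composition of two involutions, as a permutation. -/
def turn : Equiv.Perm X := hσ.toPerm * hτ.toPerm

theorem turn_apply (x : X) : turn hτ hσ x = σ (τ x) := rfl

theorem toPerm_turn_zpow (k : ℤ) (x : X) :
    τ ((turn hτ hσ ^ k) x) = (turn hτ hσ ^ (-k)) (τ x) := by
  have h1 : SemiconjBy hτ.toPerm (turn hτ hσ) (turn hτ hσ)⁻¹ := by
    refine eq_inv_mul_of_mul_eq ?_
    ext y
    simp [turn, hσ _, hτ _]
  have h2 := congrArg (fun p : Equiv.Perm X => p x) (h1.zpow_right k)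
  rw [inv_zpow'] at h2
  exact h2

theorem sameCycle_turn_map {x y : X} (h : (turn hτ hσ).SameCycle x y) :
    (turn hτ hσ).SameCycle (τ x) (τ y) := by
  obtain ⟨k, rfl⟩ := h
  exact ⟨-k, (toPerm_turn_zpow hτ hσ k x).symm⟩

theorem sameCycle_turn_swap (x : X) : (turn hτ hσ).SameCycle (τ x) (σ x) :=
  ⟨1, by rw [zpow_one, turn_apply, hτ]⟩

/-- If `turn ^ k` took `x` to `τ x`, then `τ` would reflect the cycle by `j ↦ k - j`. For even `k`
the midpoint is fixed by `τ`; for odd `k` the two middle points are exchanged by `τ`, and `σ` has a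
fixed point. -/
theorem not_sameCycle_turn (hτ' : ∀ x, τ x ≠ x) (hσ' : ∀ x, σ x ≠ x) (x : X) :
    ¬ (turn hτ hσ).SameCycle x (τ x) := by
  rintro ⟨k, hk⟩
  have key : ∀ j : ℤ, τ ((turn hτ hσ ^ j) x) = (turn hτ hσ ^ (k - j)) x := by
    intro j
    rw [toPerm_turn_zpow hτ hσ, ← hk, ← Equiv.Perm.mul_apply, ← zpow_add]
    congr 2
    ring
  rcases Int.even_or_odd' k with ⟨j, hj | hj⟩
  · have h1 := key j
    rw [show k - j = j by omega] at h1
    exact hτ' _ h1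
  · have h1 := key j
    rw [show k - j = 1 + j by omega, zpow_add, zpow_one, Equiv.Perm.mul_apply, turn_apply] at h1
    exact hσ' _ h1.symm

theorem exists_alternating_of_involutive {Q : Type*} {τ : Q → Q} (hτ : Function.Involutive τ)
    (hτ' : ∀ x, τ x ≠ x) : ∃ g : Q → Bool, ∀ x, g (τ x) = !g x := by
  classical
  -- An arbitrary linear order singles out one element of each pair `{x, τ x}`.
  obtain ⟨_, _⟩ := exists_wellFoundedLT Q
  refine ⟨fun x => decide (x < τ x), fun x => ?_⟩
  dsimp only
  rw [hτ]
  rcases lt_or_gt_of_ne (hτ' x) with h | h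
  · simp [h, h.le]
  · simp [h, h.le]

/-- The graph formed by two fixed point free involutions is bipartite. -/
theorem exists_labeling_true_true (hτ : Function.Involutive τ) (hσ : Function.Involutive σ)
    (hτ' : ∀ x, τ x ≠ x) (hσ' : ∀ x, σ x ≠ x) :
    Nonempty (Labeling τ σ true true) := by
  let s := Equiv.Perm.SameCycle.setoid (turn hτ hσ)
  -- `τ` pairs up the cycles of `turn` without fixing any. Since `τ x` and `σ x` lie in the same
  -- cycle, a labeling of cycles that flips under `τ` flips under `σ` as well.
  let τ' : Quotient s → Quotient s := Quotient.map τ fun x y h => sameCycle_turn_map hτ hσ h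
  have h1 : Function.Involutive τ' := by
    intro q
    induction q using Quotient.ind
    exact congrArg (Quotient.mk s) (hτ _)
  have h2 : ∀ q, τ' q ≠ q := by
    intro q
    induction q using Quotient.ind
    intro h
    exact not_sameCycle_turn hτ hσ hτ' hσ' _ (Quotient.exact h).symm
  obtain ⟨g, hg⟩ := exists_alternating_of_involutive h1 h2
  have h3 : ∀ x, g (Quotient.mk s (τ x)) = !g (Quotient.mk s x) := fun x => hg (Quotient.mk s x)
  refine ⟨fun x => g (Quotient.mk s x), fun x => ?_, fun x => ?_⟩ <;> dsimp only
  · rw [h3, Bool.xor_true]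
  · rw [← Quotient.sound (s := s) (sameCycle_turn_swap hτ hσ x), h3, Bool.xor_true]

/-- Take the parity of the exponent that leads from a chosen representative of the cycle to `x`.
Exponents are determined modulo the period, so for even periods this parity is well defined, and one
step of `φ` changes it. -/
theorem exists_alternating_of_even_minimalPeriod {φ : Equiv.Perm X}
    (hφ : ∀ x, Even (Function.minimalPeriod φ x)) : ∃ k : X → Bool, ∀ x, k (φ x) = !k x := by
  classical
  let s := Equiv.Perm.SameCycle.setoid φ
  choose i hi using fun x => (Quotient.exact (Quotient.out_eq (Quotient.mk s x)) :
    φ.SameCycle (Quotient.out (Quotient.mk s x)) x)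
  refine ⟨fun x => decide (Even (i x)), fun x => ?_⟩
  have h1 : Quotient.mk s (φ x) = Quotient.mk s x :=
    Quotient.sound (s := s) (show φ.SameCycle (φ x) x from ⟨-1, by simp⟩)
  have h2 := hi (φ x)
  rw [h1] at h2
  have h3 : (φ ^ (i (φ x) - i x - 1)) x = x := by
    have h4 : i (φ x) - i x - 1 = -1 + (i (φ x) + -(i x)) := by ring
    have h5 : (φ ^ (-(i x))) x = Quotient.out (Quotient.mk s x) := by
      rw [zpow_neg, Equiv.Perm.inv_eq_iff_eq, hi x]
    rw [h4, zpow_add, zpow_add, Equiv.Perm.mul_apply, Equiv.Perm.mul_apply, h5, h2]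
    simp
  have h6 : ((Function.minimalPeriod φ x : ℕ) : ℤ) ∣ i (φ x) - i x - 1 :=
    (MulAction.zpow_smul_eq_iff_minimalPeriod_dvd (a := φ) (b := x)).1 h3
  have h7 : Even (i (φ x) - i x - 1) := by
    rw [even_iff_two_dvd]
    refine dvd_trans ?_ h6
    exact_mod_cast even_iff_two_dvd.1 (hφ x)
  have h8 : Even (i (φ x)) ↔ ¬ Even (i x) := by
    rw [Int.even_sub_one, Int.even_sub] at h7
    tauto
  simp only [h8, decide_not]

/-- The labeling `g` tells apart the two `turn`-cycles of a class, which `τ` exchanges. An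
alternating function `k` is used on one of them and transported by `τ` to the other, which makes the
result constant along `τ`; it flips along `σ` because `k` flips along `turn`. -/
theorem exists_labeling_false_true (hτ' : ∀ x, τ x ≠ x) (hσ' : ∀ x, σ x ≠ x)
    (heven : ∀ x, Even (Function.minimalPeriod (turn hτ hσ) x)) :
    Nonempty (Labeling τ σ false true) := by
  obtain ⟨g, hgτ, hgσ⟩ := exists_labeling_true_true hτ hσ hτ' hσ'
  obtain ⟨k, hk⟩ := exists_alternating_of_even_minimalPeriod heven
  have h1 : ∀ x, k (σ x) = !k (τ x) := fun x => by rw [← hk, turn_apply, hτ]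
  have h2 : ∀ x, k (τ (σ x)) = !k x := fun x => by
    rw [← Bool.not_not (k (τ (σ x))), ← hk, turn_apply, hτ, hσ]
  refine ⟨fun x => if g x = true then k x else k (τ x), fun x => ?_, fun x => ?_⟩
  · dsimp only
    rw [hgτ, hτ]
    cases g x <;> simp
  · dsimp only
    rw [hgσ, h1, h2]
    cases g x <;> simp

/-- A class is a `turn`-cycle together with its mirror image, because `τ` reverses the rotation
`turn` and `σ` is `turn` after `τ`. -/
theorem linked_class_iff (x y : X) : Quot.mk (Linked τ σ) x = Quot.mk (Linked τ σ) y ↔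
    (turn hτ hσ).SameCycle x y ∨ (turn hτ hσ).SameCycle x (τ y) := by
  constructor
  · intro h
    let P : X → Prop := fun z => (turn hτ hσ).SameCycle x z ∨ (turn hτ hσ).SameCycle x (τ z)
    have hP : ∀ z w, Linked τ σ z w → P z = P w := by
      rintro z w (rfl | rfl)
      · simp only [P, hτ z]
        exact propext or_comm
      · have h1 := sameCycle_turn_swap hτ hσ z
        have h2 : (turn hτ hσ).SameCycle (τ (σ z)) z := by
          have := sameCycle_turn_map hτ hσ h1
          rw [hτ] at this
          exact this.symm
        refine propext ⟨?_, ?_⟩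
        · rintro (h | h)
          · exact Or.inr (h.trans h2.symm)
          · exact Or.inl (h.trans h1)
        · rintro (h | h)
          · exact Or.inr (h.trans h1.symm)
          · exact Or.inl (h.trans h2)
    have h1 : P x = P y := congrArg (Quot.lift P hP) h
    exact h1.mp (Or.inl (Equiv.Perm.SameCycle.refl _ x))
  · have key : ∀ z, (turn hτ hσ).SameCycle x z →
        Quot.mk (Linked τ σ) x = Quot.mk (Linked τ σ) z := by
      rintro z ⟨k, rfl⟩
      induction k with
      | zero => simp
      | succ k ih =>
        rw [add_comm, zpow_add, zpow_one, Equiv.Perm.mul_apply, turn_apply, mk_linked_right, mk_linked_left]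
        exact ih
      | pred k ih =>
        have h1 : (turn hτ hσ ^ (-k : ℤ)) x = turn hτ hσ ((turn hτ hσ ^ (-k - 1 : ℤ)) x) := by
          rw [← Equiv.Perm.mul_apply, ← zpow_one_add, add_sub_cancel]
        rw [ih, h1, turn_apply, mk_linked_right, mk_linked_left]
    rintro (h | h)
    · exact key y h
    · rw [key _ h, mk_linked_left]

/-- If the fibers of `ε` are the orbits of `τ`, then the period of the composition at `x` is the
number of values of `ε` on the class of `x`. -/
theorem minimalPeriod_turn_eq_ncard [Finite X] (hτ' : ∀ x, τ x ≠ x) (hσ' : ∀ x, σ x ≠ x)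
    {Y : Type*} (ε : X → Y) (hε : ∀ x y, ε x = ε y ↔ y = x ∨ y = τ x) (x : X) :
    Function.minimalPeriod (turn hτ hσ) x =
      (ε '' {y | Quot.mk (Linked τ σ) x = Quot.mk (Linked τ σ) y}).ncard := by
  rw [minimalPeriod_eq_ncard_sameCycle]
  have h1 : ε '' {y | Quot.mk (Linked τ σ) x = Quot.mk (Linked τ σ) y} =
      ε '' {y | (turn hτ hσ).SameCycle x y} := by
    ext e
    constructor
    · rintro ⟨y, hy, rfl⟩
      rcases (linked_class_iff hτ hσ x y).1 hy with h | h
      · exact ⟨y, h, rfl⟩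
      · exact ⟨τ y, h, ((hε _ _).2 (Or.inr rfl)).symm⟩
    · rintro ⟨y, hy, rfl⟩
      exact ⟨y, (linked_class_iff hτ hσ x y).2 (Or.inl hy), rfl⟩
  -- On a single `turn`-cycle `ε` is injective, since `y` and `τ y` are in different cycles.
  rw [h1, Set.InjOn.ncard_image]
  intro y hy z hz hyz
  rcases (hε y z).1 hyz with h | h
  · exact h.symm
  · subst h
    exact absurd (Equiv.Perm.SameCycle.trans (Equiv.Perm.SameCycle.symm hy) hz)
      (not_sameCycle_turn hτ hσ hτ' hσ' y)

end Involutions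

end VertexHomology

namespace VertexHomology
namespace OrientedRibbonGraph

variable {α β H : Type*} {G : Graph α β} (Γ : OrientedRibbonGraph G H)

/-! ### Perfect matchings -/

/-- Counting half-edges instead of edges excludes loops automatically: a loop in `M` would give two
matched half-edges at its vertex. -/
theorem isPerfectMatching_iff {M : Set β} : IsPerfectMatching G M ↔
    M ⊆ E(G) ∧ ∀ v, ∃! h, Γ.vert h = v ∧ (Γ.edge h : β) ∈ M := by
  constructor
  · rintro ⟨h1, h2⟩
    have hno : ∀ h, (Γ.edge h : β) ∈ M → Γ.vert (Γ.opp h) ≠ Γ.vert h := by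
      intro h hh heq
      obtain ⟨x, hx⟩ := h1 _ hh
      exact hx.not_isLoopAt _ (Γ.isLoopAt_iff.2 ⟨rfl, congrArg Subtype.val heq⟩)
    refine ⟨fun e he => (h1 e he).choose_spec.edge_mem, fun v => ?_⟩
    obtain ⟨e, ⟨heM, hev⟩, huniq⟩ := h2 v v.2
    obtain ⟨h, rfl, hhv⟩ := Γ.inc_iff.1 hev
    have hhv' : Γ.vert h = v := Subtype.ext hhv
    refine ⟨h, ⟨hhv', heM⟩, ?_⟩
    rintro k ⟨hkv, hkM⟩
    have h3 := huniq _ ⟨hkM, Γ.inc_iff.2 ⟨k, rfl, congrArg Subtype.val hkv⟩⟩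
    rcases (Γ.edge_val_eq_iff k h).1 h3 with h4 | h4
    · exact h4.symm
    · exact absurd (by rw [← h4, hhv', hkv]) (hno k hkM)
  · rintro ⟨h1, h2⟩
    constructor
    · intro e he
      obtain ⟨h, rfl⟩ := Γ.exists_edge_eq (h1 he)
      refine ⟨Γ.vert h, Γ.isNonloopAt_iff.2 (Or.inl ⟨rfl, fun h3 => ?_⟩)⟩
      exact Γ.opp_ne h ((h2 (Γ.vert h)).unique ⟨Subtype.ext h3, by rwa [edge_opp]⟩ ⟨rfl, he⟩)
    · intro x hx
      obtain ⟨h, ⟨hv, hM⟩, huniq⟩ := h2 ⟨x, hx⟩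
      refine ⟨Γ.edge h, ⟨hM, Γ.inc_iff.2 ⟨h, rfl, by rw [hv]⟩⟩, ?_⟩
      rintro e ⟨he, hex⟩
      obtain ⟨k, rfl, hk⟩ := Γ.inc_iff.1 hex
      rw [huniq k ⟨Subtype.ext hk, he⟩]

variable {M : Set β}

-- Every vertex has exactly one matched half-edge, and every edge of `M` has two halves.
include Γ in
theorem ncard_vertexSet_eq [Finite H] (hM : IsPerfectMatching G M) :
    V(G).ncard = 2 * M.ncard := by
  obtain ⟨h1, h2⟩ := Γ.isPerfectMatching_iff.1 hM
  rw [← Γ.ncard_edge_mem M h1]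
  have h3 : V(G) = (fun h => (Γ.vert h : α)) '' {h | (Γ.edge h : β) ∈ M} := by
    ext x
    constructor
    · intro hx
      obtain ⟨h, ⟨hv, hm⟩, -⟩ := h2 ⟨x, hx⟩
      exact ⟨h, hm, congrArg Subtype.val hv⟩
    · rintro ⟨h, -, rfl⟩
      exact (Γ.vert h).2
  conv_lhs => rw [h3]
  refine Set.InjOn.ncard_image ?_
  intro h hh k hk hhk
  exact (h2 (Γ.vert k)).unique ⟨Subtype.ext hhk, hh⟩ ⟨rfl, hk⟩

/-- The half-edges on edges outside of `M`. -/
abbrev Unmatched (M : Set β) : Type _ := {h : H // (Γ.edge h : β) ∉ M}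

/-- The other half of an unmatched edge. -/
def unmatchedOpp (M : Set β) (n : Γ.Unmatched M) : Γ.Unmatched M :=
  ⟨Γ.opp n.1, by rw [edge_opp]; exact n.2⟩

theorem unmatchedOpp_involutive : Function.Involutive (Γ.unmatchedOpp M) :=
  fun n => Subtype.ext (Γ.opp_opp n.1)

theorem unmatchedOpp_ne (n : Γ.Unmatched M) : Γ.unmatchedOpp M n ≠ n :=
  fun h => Γ.opp_ne n.1 (congrArg Subtype.val h)

open scoped Classical in
/-- The other unmatched half-edge at the same vertex. -/
noncomputable def unmatchedTurn (M : Set β) (n : Γ.Unmatched M) : Γ.Unmatched M :=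
  if h : (Γ.edge (Γ.rot n.1) : β) ∉ M then ⟨Γ.rot n.1, h⟩
  -- For a perfect matching of a trivalent graph the default value `n` is never reached.
  else if h' : (Γ.edge (Γ.rot (Γ.rot n.1)) : β) ∉ M then ⟨Γ.rot (Γ.rot n.1), h'⟩ else n

section

variable [Finite H] (htri : IsTrivalent G) (hM : IsPerfectMatching G M)
include htri hM

/-- The matched half-edge at a vertex and the two unmatched ones. -/
theorem exists_matched (v : V(G)) : ∃ p, Γ.vert p = v ∧ (Γ.edge p : β) ∈ M ∧
    (Γ.edge (Γ.rot p) : β) ∉ M ∧ (Γ.edge (Γ.rot (Γ.rot p)) : β) ∉ M := by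
  obtain ⟨p, ⟨hv, hp⟩, huniq⟩ := (Γ.isPerfectMatching_iff.1 hM).2 v
  refine ⟨p, hv, hp, fun h => ?_, fun h => ?_⟩
  · exact Γ.rot_ne htri p (huniq _ ⟨by rw [vert_rot, hv], h⟩)
  · exact Γ.rot_rot_ne htri p (huniq _ ⟨by rw [vert_rot, vert_rot, hv], h⟩)

omit hM in
theorem unmatchedTurn_rot {p : H} (hp : (Γ.edge p : β) ∈ M) (h1 : (Γ.edge (Γ.rot p) : β) ∉ M)
    (h2 : (Γ.edge (Γ.rot (Γ.rot p)) : β) ∉ M) :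
    Γ.unmatchedTurn M ⟨Γ.rot p, h1⟩ = ⟨Γ.rot (Γ.rot p), h2⟩ ∧
      Γ.unmatchedTurn M ⟨Γ.rot (Γ.rot p), h2⟩ = ⟨Γ.rot p, h1⟩ := by
  constructor
  · simp [unmatchedTurn, h2]
  · simp [unmatchedTurn, Γ.rot_rot_rot htri, hp, h1]

theorem exists_rot_eq (n : Γ.Unmatched M) : ∃ (p : H) (_ : (Γ.edge p : β) ∈ M)
    (h1 : (Γ.edge (Γ.rot p) : β) ∉ M) (h2 : (Γ.edge (Γ.rot (Γ.rot p)) : β) ∉ M),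
    Γ.vert p = Γ.vert n.1 ∧ (n = ⟨Γ.rot p, h1⟩ ∨ n = ⟨Γ.rot (Γ.rot p), h2⟩) := by
  obtain ⟨p, hv, hp, h1, h2⟩ := Γ.exists_matched htri hM (Γ.vert n.1)
  refine ⟨p, hp, h1, h2, hv, ?_⟩
  rcases (Γ.vert_eq_iff_rot htri p n.1).1 hv.symm with h3 | h3 | h3
  · exact absurd (h3 ▸ hp) n.2
  · exact Or.inl (Subtype.ext h3)
  · exact Or.inr (Subtype.ext h3)

theorem unmatchedTurn_involutive : Function.Involutive (Γ.unmatchedTurn M) := by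
  intro n
  obtain ⟨p, hp, h1, h2, -, rfl | rfl⟩ := Γ.exists_rot_eq htri hM n
  · rw [(Γ.unmatchedTurn_rot htri hp h1 h2).1, (Γ.unmatchedTurn_rot htri hp h1 h2).2]
  · rw [(Γ.unmatchedTurn_rot htri hp h1 h2).2, (Γ.unmatchedTurn_rot htri hp h1 h2).1]

theorem unmatchedTurn_ne (n : Γ.Unmatched M) : Γ.unmatchedTurn M n ≠ n := by
  obtain ⟨p, hp, h1, h2, -, rfl | rfl⟩ := Γ.exists_rot_eq htri hM n
  · rw [(Γ.unmatchedTurn_rot htri hp h1 h2).1]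
    exact fun h => Γ.rot_ne htri _ (congrArg Subtype.val h)
  · rw [(Γ.unmatchedTurn_rot htri hp h1 h2).2]
    exact fun h => Γ.rot_ne htri _ (congrArg Subtype.val h).symm

theorem vert_eq_iff_unmatched (n k : Γ.Unmatched M) :
    Γ.vert k.1 = Γ.vert n.1 ↔ k = n ∨ k = Γ.unmatchedTurn M n := by
  obtain ⟨p, hp, h1, h2, hv, hn⟩ := Γ.exists_rot_eq htri hM n
  obtain ⟨e1, e2⟩ := Γ.unmatchedTurn_rot htri hp h1 h2
  rw [← hv, Γ.vert_eq_iff_rot htri]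
  have hkp : k.1 ≠ p := fun h => k.2 (h ▸ hp)
  rcases hn with rfl | rfl
  · rw [e1, Subtype.ext_iff, Subtype.ext_iff]
    tauto
  · rw [e2, Subtype.ext_iff, Subtype.ext_iff]
    tauto

/-! ### The cycles of the complement of a perfect matching -/

omit [Finite H] htri hM in
theorem edge_unmatched_eq_iff (n k : Γ.Unmatched M) :
    (Γ.edge n.1 : β) = Γ.edge k.1 ↔ k = n ∨ k = Γ.unmatchedOpp M n := by
  rw [edge_val_eq_iff, Subtype.ext_iff, Subtype.ext_iff]
  rfl

/-- The classes of unmatched half-edges. -/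
abbrev UnmatchedClass (M : Set β) : Type _ := Quot (Linked (Γ.unmatchedOpp M) (Γ.unmatchedTurn M))

/-- The edges of a class of unmatched half-edges. -/
def classEdges (M : Set β) (q : Γ.UnmatchedClass M) : Set β :=
  (fun n : Γ.Unmatched M => (Γ.edge n.1 : β)) '' {n | Quot.mk _ n = q}

omit [Finite H] htri hM in
theorem mem_classEdges_iff (n : Γ.Unmatched M) (q : Γ.UnmatchedClass M) :
    (Γ.edge n.1 : β) ∈ Γ.classEdges M q ↔ Quot.mk _ n = q := by
  constructor
  · rintro ⟨k, hk, hkn⟩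
    rcases (Γ.edge_unmatched_eq_iff k n).1 hkn with rfl | rfl
    · exact hk
    · rw [mk_linked_left]
      exact hk
  · intro h
    exact ⟨n, h, rfl⟩

omit [Finite H] htri hM in
theorem classEdges_injective : Function.Injective (Γ.classEdges M) := by
  intro q q' h
  induction q using Quot.ind with
  | mk n => exact (Γ.mem_classEdges_iff n q').1 (h ▸ (Γ.mem_classEdges_iff n _).2 rfl)

theorem degree_restrict_eq {C : Set β} (hC : C ⊆ E(G) \ M) (n : Γ.Unmatched M) :
    degree ((G.deleteEdges M).restrict C) (Γ.vert n.1) =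
      ((Subtype.val : Γ.Unmatched M → H) ''
        {k | (k = n ∨ k = Γ.unmatchedTurn M n) ∧ (Γ.edge k.1 : β) ∈ C}).ncard := by
  rw [Γ.degree_eq_ncard (F := C)]
  · congr 1
    ext h
    constructor
    · rintro ⟨h1, h2⟩
      exact ⟨⟨h, (hC h2).2⟩, ⟨(Γ.vert_eq_iff_unmatched htri hM _ _).1 (Subtype.ext h1), h2⟩, rfl⟩
    · rintro ⟨k, ⟨h1, h2⟩, rfl⟩
      exact ⟨congrArg Subtype.val ((Γ.vert_eq_iff_unmatched htri hM _ _).2 h1), h2⟩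
  · intro e x y
    rw [Graph.restrict_isLink, Graph.deleteEdges_isLink]
    constructor
    · tauto
    · rintro ⟨h1, h2⟩
      exact ⟨h2, h1, (hC h2).2⟩

theorem isCycle_classEdges (q : Γ.UnmatchedClass M) :
    IsCycle (G.deleteEdges M) (Γ.classEdges M q) := by
  have hsub : Γ.classEdges M q ⊆ E(G) \ M := by
    rintro _ ⟨n, -, rfl⟩
    exact ⟨(Γ.edge n.1).2, n.2⟩
  refine ⟨?_, ?_, ?_, ?_⟩
  · induction q using Quot.ind with
    | mk n => exact ⟨_, n, rfl, rfl⟩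
  · rw [Graph.edgeSet_deleteEdges]
    exact hsub
  · have hinc : ∀ n : Γ.Unmatched M, (G.deleteEdges M).Inc (Γ.edge n.1) (Γ.vert n.1) := fun n =>
      Graph.deleteEdges_inc.2 ⟨Γ.inc_iff.2 ⟨n.1, rfl, rfl⟩, n.2⟩
    rintro _ ⟨n, hn, rfl⟩ _ ⟨k, hk, rfl⟩
    have h1 : Relation.EqvGen (Linked (Γ.unmatchedOpp M) (Γ.unmatchedTurn M)) n k :=
      Quot.eqvGen_exact (Eq.trans hn (Eq.symm hk))
    let R : β → β → Prop := fun a b => b ∈ Γ.classEdges M q ∧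
      ∃ x, (G.deleteEdges M).Inc a x ∧ (G.deleteEdges M).Inc b x
    have key : ∀ n k : Γ.Unmatched M, Linked (Γ.unmatchedOpp M) (Γ.unmatchedTurn M) n k →
        Quot.mk _ n = q → R (Γ.edge n.1) (Γ.edge k.1) ∧ R (Γ.edge k.1) (Γ.edge n.1) := by
      intro n k hnk hn
      have hk : Quot.mk _ k = q := (Quot.sound hnk).symm.trans hn
      have hx : ∃ x, (G.deleteEdges M).Inc (Γ.edge n.1) x ∧
          (G.deleteEdges M).Inc (Γ.edge k.1) x := by
        refine ⟨Γ.vert n.1, hinc n, ?_⟩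
        rcases hnk with rfl | rfl
        · have := hinc n
          rwa [(Γ.edge_unmatched_eq_iff _ _).2 (Or.inr rfl)] at this
        · have := hinc (Γ.unmatchedTurn M n)
          rwa [(Γ.vert_eq_iff_unmatched htri hM n _).2 (Or.inr rfl)] at this
      obtain ⟨x, hx1, hx2⟩ := hx
      exact ⟨⟨⟨k, hk, rfl⟩, x, hx1, hx2⟩, ⟨⟨n, hn, rfl⟩, x, hx2, hx1⟩⟩
    -- Chains in both directions are carried along, which settles the symmetric case of `EqvGen`.
    have main : ∀ n k : Γ.Unmatched M,
        Relation.EqvGen (Linked (Γ.unmatchedOpp M) (Γ.unmatchedTurn M)) n k →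
        Quot.mk _ n = q → Relation.ReflTransGen R (Γ.edge n.1) (Γ.edge k.1) ∧
          Relation.ReflTransGen R (Γ.edge k.1) (Γ.edge n.1) := by
      intro n k h
      induction h with
      | rel n k h => exact fun hn => ⟨.single (key n k h hn).1, .single (key n k h hn).2⟩
      | refl n => exact fun _ => ⟨.refl, .refl⟩
      | symm n k h ih => exact fun hn => (ih ((Quot.eqvGen_sound h).trans hn)).symm
      | trans n k l h h' ih ih' =>
        intro hn
        have h1 := ih hn
        have h2 := ih' ((Quot.eqvGen_sound h).symm.trans hn)
        exact ⟨h1.1.trans h2.1, h2.2.trans h1.2⟩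
    exact (main n k h1 hn).1
  · rintro x ⟨e, he, hex⟩
    obtain ⟨h, rfl, rfl⟩ := Γ.inc_iff.1 (Graph.deleteEdges_inc.1 hex).1
    let n : Γ.Unmatched M := ⟨h, (hsub he).2⟩
    have hn := (Γ.mem_classEdges_iff n q).1 he
    rw [Γ.degree_restrict_eq htri hM hsub n, Set.ncard_image_of_injective _ Subtype.val_injective]
    rw [← Set.ncard_pair (Γ.unmatchedTurn_ne htri hM n).symm]
    congr 1
    ext k
    simp only [Set.mem_ofPred_eq, Set.mem_insert_iff, Set.mem_singleton_iff, and_iff_left_iff_imp]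
    rintro (rfl | rfl)
    · exact he
    · rw [mem_classEdges_iff, mk_linked_right, hn]

/-- Degree two forces a cycle to contain both unmatched edge ends at every vertex it meets, so it
contains the whole class of each of its half-edges. Connectedness gives the other inclusion. -/
theorem exists_classEdges_eq {C : Set β} (hC : IsCycle (G.deleteEdges M) C) :
    ∃ q, Γ.classEdges M q = C := by
  obtain ⟨⟨e, he⟩, hsub, hconn, hdeg⟩ := hC
  rw [Graph.edgeSet_deleteEdges] at hsub
  obtain ⟨h, rfl⟩ := Γ.exists_edge_eq (hsub he).1
  have hturn : ∀ n : Γ.Unmatched M, (Γ.edge n.1 : β) ∈ C →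
      (Γ.edge (Γ.unmatchedTurn M n).1 : β) ∈ C := by
    intro n hn
    have h1 := hdeg (Γ.vert n.1) ⟨_, hn, Graph.deleteEdges_inc.2
      ⟨Γ.inc_iff.2 ⟨n.1, rfl, rfl⟩, n.2⟩⟩
    rw [Γ.degree_restrict_eq htri hM hsub n,
      Set.ncard_image_of_injective _ Subtype.val_injective] at h1
    have h2 : {k | (k = n ∨ k = Γ.unmatchedTurn M n) ∧ (Γ.edge k.1 : β) ∈ C} =
        {n, Γ.unmatchedTurn M n} := by
      refine Set.eq_of_subset_of_ncard_le ?_ ?_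
      · rintro k ⟨hk, -⟩
        exact hk
      · rw [h1]
        exact (Set.ncard_insert_le _ _).trans (by rw [Set.ncard_singleton])
    exact (h2.ge (Or.inr rfl)).2
  let n : Γ.Unmatched M := ⟨h, (hsub he).2⟩
  refine ⟨Quot.mk _ n, Set.Subset.antisymm ?_ ?_⟩
  · let P : Γ.Unmatched M → Prop := fun k => (Γ.edge k.1 : β) ∈ C
    have hP : ∀ k l, Linked (Γ.unmatchedOpp M) (Γ.unmatchedTurn M) k l → P k = P l := by
      rintro k l (rfl | rfl)
      · simp only [P, ← (Γ.edge_unmatched_eq_iff _ _).2 (Or.inr rfl)]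
      · refine propext ⟨hturn k, fun h1 => ?_⟩
        have h2 := hturn _ h1
        rwa [Γ.unmatchedTurn_involutive htri hM] at h2
    rintro _ ⟨k, hk, rfl⟩
    have h1 : P k = P n := congrArg (Quot.lift P hP) hk
    exact h1.mpr he
  · intro f hf
    have h1 := hconn _ he f hf
    clear hf
    induction h1 with
    | refl => exact (Γ.mem_classEdges_iff n _).2 rfl
    | tail _ hbc ih =>
      obtain ⟨hc, x, hbx, hcx⟩ := hbc
      obtain ⟨k, rfl, hk⟩ := Γ.inc_iff.1 (Graph.deleteEdges_inc.1 hbx).1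
      obtain ⟨l, rfl, hl⟩ := Γ.inc_iff.1 (Graph.deleteEdges_inc.1 hcx).1
      let k' : Γ.Unmatched M := ⟨k, (Graph.deleteEdges_inc.1 hbx).2⟩
      let l' : Γ.Unmatched M := ⟨l, (Graph.deleteEdges_inc.1 hcx).2⟩
      have h2 : Quot.mk _ k' = Quot.mk _ n := (Γ.mem_classEdges_iff k' _).1 ih
      refine (Γ.mem_classEdges_iff l' _).2 ?_
      rcases (Γ.vert_eq_iff_unmatched htri hM k' l').1 (Subtype.ext (hl.trans hk.symm)) with h3 | h3
      · rw [h3, h2]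
      · rw [h3, mk_linked_right, h2]

theorem card_unmatchedClass : Nat.card (Γ.UnmatchedClass M) = (cyclesOfCompl G M).ncard := by
  rw [← Set.ncard_range_of_injective Γ.classEdges_injective]
  congr 1
  ext C
  constructor
  · rintro ⟨q, rfl⟩
    exact Γ.isCycle_classEdges htri hM q
  · exact Γ.exists_classEdges_eq htri hM

theorem card_orientations :
    Nat.card (Labeling (Γ.unmatchedOpp M) (Γ.unmatchedTurn M) true true) =
      2 ^ (cyclesOfCompl G M).ncard := by
  obtain ⟨g₀⟩ := exists_labeling_true_true Γ.unmatchedOpp_involutive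
    (Γ.unmatchedTurn_involutive htri hM) Γ.unmatchedOpp_ne (Γ.unmatchedTurn_ne htri hM)
  rw [card_labeling_of_nonempty g₀, Γ.card_unmatchedClass htri hM]

theorem card_alternatingColorings_le :
    Nat.card (Labeling (Γ.unmatchedOpp M) (Γ.unmatchedTurn M) false true) ≤
      2 ^ (cyclesOfCompl G M).ncard := by
  rw [← Γ.card_unmatchedClass htri hM]
  exact card_labeling_le _ _

theorem card_alternatingColorings (heven : IsEvenMatching G M) :
    Nat.card (Labeling (Γ.unmatchedOpp M) (Γ.unmatchedTurn M) false true) =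
      2 ^ (cyclesOfCompl G M).ncard := by
  obtain ⟨k₀⟩ := exists_labeling_false_true Γ.unmatchedOpp_involutive
    (Γ.unmatchedTurn_involutive htri hM) Γ.unmatchedOpp_ne (Γ.unmatchedTurn_ne htri hM)
    (fun n => by
      -- The period of the composed involution is the length of the cycle, which is even by
      -- hypothesis.
      rw [minimalPeriod_turn_eq_ncard Γ.unmatchedOpp_involutive
        (Γ.unmatchedTurn_involutive htri hM) Γ.unmatchedOpp_ne (Γ.unmatchedTurn_ne htri hM)
        _ Γ.edge_unmatched_eq_iff]
      have := heven _ (Γ.isCycle_classEdges htri hM (Quot.mk _ n))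
      simpa only [classEdges, eq_comm] using this)
  rw [card_labeling_of_nonempty k₀, Γ.card_unmatchedClass htri hM]

end

end OrientedRibbonGraph
end VertexHomology

namespace VertexHomology
namespace OrientedRibbonGraph

variable {α β H : Type*} {G : Graph α β} (Γ : OrientedRibbonGraph G H)

/-! ### Vertex states with colored corners -/

/-- The color at the left (`true`) or right (`false`) of a half-edge, next to the vertex. -/
def innerColor (f : H → Bool) (h : H) (s : Bool) : Bool := if s then f h else f (Γ.rot.symm h)

/-- The color at the left or right of a half-edge, next to the bubble. -/
def outerColor (p : (V(G) → Bool) × (H → Bool)) (h : H) (s : Bool) : Bool :=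
  Γ.innerColor p.2 h (xor s (p.1 (Γ.vert h)))

/-- A vertex state together with colors of the corners that fit along the edges. -/
def IsCornerColoring (p : (V(G) → Bool) × (H → Bool)) : Prop :=
  ∀ h, Γ.outerColor p h true = Γ.outerColor p (Γ.opp h) false

/-- A corner coloring in which the corners at each vertex do not all have the same color. -/
def IsProperCornerColoring (p : (V(G) → Bool) × (H → Bool)) : Prop :=
  Γ.IsCornerColoring p ∧ ∀ v, ∃ h, Γ.vert h = v ∧ p.2 h ≠ p.2 (Γ.rot.symm h)

/-- The corner coloring given by a coloring of the circles of a vertex state. -/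
def cornersOf (x : Σ ν : V(G) → Bool, (Γ.Circle (Γ.ofVertexState ν) → Fin 2)) :
    (V(G) → Bool) × (H → Bool) :=
  (x.1, fun h => finTwoEquiv (x.2 (Γ.circle _ (Γ.inner h true))))

theorem circle_inner_false (a : H → Bool) (h : H) :
    Γ.circle a (Γ.inner h false) = Γ.circle a (Γ.inner (Γ.rot.symm h) true) :=
  (Γ.circle_across a (Γ.inner h false)).symm

theorem innerColor_cornersOf (x : Σ ν : V(G) → Bool, (Γ.Circle (Γ.ofVertexState ν) → Fin 2))
    (h : H) (s : Bool) : Γ.innerColor (Γ.cornersOf x).2 h s =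
      finTwoEquiv (x.2 (Γ.circle _ (Γ.inner h s))) := by
  cases s
  · rw [circle_inner_false]
    rfl
  · rfl

theorem outerColor_cornersOf (x : Σ ν : V(G) → Bool, (Γ.Circle (Γ.ofVertexState ν) → Fin 2))
    (h : H) (s : Bool) : Γ.outerColor (Γ.cornersOf x) h s =
      finTwoEquiv (x.2 (Γ.circle _ (Γ.outer h s))) := by
  rw [outerColor, innerColor_cornersOf, ← Γ.circle_along _ (Γ.outer h s)]
  rfl

theorem cornersOf_injective : Function.Injective Γ.cornersOf := by
  rintro ⟨ν, I⟩ ⟨ν', I'⟩ h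
  obtain rfl : ν = ν' := congrArg Prod.fst h
  congr 1
  funext c
  obtain ⟨⟨b, k, s⟩, rfl⟩ := Γ.circle_surjective _ c
  apply finTwoEquiv.injective
  cases b
  · have h1 := Γ.innerColor_cornersOf ⟨ν, I⟩ k s
    rw [h, Γ.innerColor_cornersOf ⟨ν, I'⟩ k s] at h1
    exact h1.symm
  · have h1 := Γ.outerColor_cornersOf ⟨ν, I⟩ k s
    rw [h, Γ.outerColor_cornersOf ⟨ν, I'⟩ k s] at h1
    exact h1.symm

theorem isCornerColoring_cornersOf
    (x : Σ ν : V(G) → Bool, (Γ.Circle (Γ.ofVertexState ν) → Fin 2)) :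
    Γ.IsCornerColoring (Γ.cornersOf x) := by
  intro h
  rw [outerColor_cornersOf, outerColor_cornersOf, Γ.circle_eq_of_arc (Arc.bubble h)]

theorem exists_cornersOf_eq {p : (V(G) → Bool) × (H → Bool)} (hp : Γ.IsCornerColoring p) :
    ∃ I : Γ.Circle (Γ.ofVertexState p.1) → Fin 2, Γ.cornersOf ⟨p.1, I⟩ = p := by
  let χ : Γ.StrandEnd → Fin 2 := fun q => finTwoEquiv.symm
    (if q.1 then Γ.outerColor p q.2.1 q.2.2 else Γ.innerColor p.2 q.2.1 q.2.2)
  refine ⟨Quot.lift χ ?_, ?_⟩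
  · intro q r hqr
    refine congrArg finTwoEquiv.symm ?_
    cases hqr with
    | corner h => simp [inner, innerColor]
    | bubble h => simpa [outer] using hp h
    | parallel h s ha =>
      have ha' : p.1 (Γ.vert h) = false := ha
      simp [inner, outer, outerColor, ha']
    | crossing h s ha =>
      have ha' : p.1 (Γ.vert h) = true := ha
      simp [inner, outer, outerColor, ha']
  · refine Prod.ext rfl (funext fun h => ?_)
    exact finTwoEquiv.apply_symm_apply _

theorem card_properColorings : Nat.card
    (Σ ν : V(G) → Bool, {I : Γ.Circle (Γ.ofVertexState ν) → Fin 2 // Γ.IsProper I}) =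
      Nat.card {p // Γ.IsProperCornerColoring p} := by
  have hproper : ∀ (ν : V(G) → Bool) (I : Γ.Circle (Γ.ofVertexState ν) → Fin 2),
      Γ.IsProper I ↔ ∀ v, ∃ h, Γ.vert h = v ∧
        (Γ.cornersOf ⟨ν, I⟩).2 h ≠ (Γ.cornersOf ⟨ν, I⟩).2 (Γ.rot.symm h) := by
    intro ν I
    simp only [IsProper, circle_inner_false, cornersOf, ne_eq, EmbeddingLike.apply_eq_iff_eq]
  refine Nat.card_congr (Equiv.ofBijective (fun x => ⟨Γ.cornersOf ⟨x.1, x.2.1⟩,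
    Γ.isCornerColoring_cornersOf _, (hproper _ _).1 x.2.2⟩) ⟨?_, ?_⟩)
  · rintro ⟨ν, I, hI⟩ ⟨ν', I', hI'⟩ h
    have h1 := Γ.cornersOf_injective (congrArg Subtype.val h)
    simp only [Sigma.mk.injEq] at h1
    obtain ⟨rfl, h2⟩ := h1
    rw [heq_eq_eq] at h2
    simp only [h2]
  · rintro ⟨p, hp, hp'⟩
    obtain ⟨I, hI⟩ := Γ.exists_cornersOf_eq hp
    exact ⟨⟨p.1, I, (hproper _ _).2 (hI.symm ▸ hp')⟩, Subtype.ext hI⟩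

/-! ### From corner colorings to perfect matchings and orientations -/

/-- The matched edges of a corner coloring are those with the same color on both sides. -/
def Matches (M : Set β) (p : (V(G) → Bool) × (H → Bool)) : Prop :=
  Γ.IsCornerColoring p ∧ ∀ h, p.2 h = p.2 (Γ.rot.symm h) ↔ (Γ.edge h : β) ∈ M

variable {Γ}

/-- The conditions at `h` and `opp h` identify the pairs of colors at the two ends of the band;
crossings only swap the two sides. -/
theorem IsCornerColoring.opp {p : (V(G) → Bool) × (H → Bool)} (hp : Γ.IsCornerColoring p) (h : H) :
    p.2 (Γ.opp h) = p.2 (Γ.rot.symm (Γ.opp h)) ↔ p.2 h = p.2 (Γ.rot.symm h) := by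
  have h1 := hp h
  have h2 := hp (Γ.opp h)
  rw [Γ.opp_opp] at h2
  revert h1 h2
  unfold outerColor innerColor
  generalize p.2 h = a
  generalize p.2 (Γ.rot.symm h) = b
  generalize p.2 (Γ.opp h) = c
  generalize p.2 (Γ.rot.symm (Γ.opp h)) = d
  generalize p.1 (Γ.vert h) = x
  generalize p.1 (Γ.vert (Γ.opp h)) = y
  revert a b c d x y
  decide

/-- Off `M` the two sides have different colors, so `f h xor ν` is the color of the left outer
strand of `h`. That strand continues as the right outer strand of `opp h`, whence the negation. -/
theorem Matches.opp {M : Set β} {p : (V(G) → Bool) × (H → Bool)} (hp : Γ.Matches M p) (h : H) :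
    ((Γ.edge h : β) ∈ M → p.2 (Γ.opp h) = p.2 h) ∧
    ((Γ.edge h : β) ∉ M → xor (p.2 (Γ.opp h)) (p.1 (Γ.vert (Γ.opp h))) =
      !xor (p.2 h) (p.1 (Γ.vert h))) := by
  have h1 := hp.1 h
  have h2 := hp.1.opp h
  rw [← hp.2 h]
  revert h1 h2
  unfold outerColor innerColor
  generalize p.2 h = a
  generalize p.2 (Γ.rot.symm h) = b
  generalize p.2 (Γ.opp h) = c
  generalize p.2 (Γ.rot.symm (Γ.opp h)) = d
  generalize p.1 (Γ.vert h) = x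
  generalize p.1 (Γ.vert (Γ.opp h)) = y
  revert a b c d x y
  decide

variable (Γ)

section

variable [Finite H] (htri : IsTrivalent G)
include htri

theorem rot_symm_eq (h : H) : Γ.rot.symm h = Γ.rot (Γ.rot h) := by
  rw [Equiv.symm_apply_eq, Γ.rot_rot_rot htri]

/-- Around a vertex the color changes an even number of times. If the corners are not all equal,
exactly two of the three half-edges separate different colors, and the third is the matched one. -/
theorem card_properCornerColorings :
    Nat.card {p // Γ.IsProperCornerColoring p} =
      Nat.card (Σ M : perfectMatchings G, {p // Γ.Matches (M : Set β) p}) := by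
  have hrot := Γ.rot_symm_eq htri
  have hrot3 := Γ.rot_rot_rot htri
  have hsides : ∀ (p : (V(G) → Bool) × (H → Bool)) (h : H), p.2 h ≠ p.2 (Γ.rot.symm h) ∨
      p.2 (Γ.rot h) ≠ p.2 (Γ.rot.symm (Γ.rot h)) ∨
      p.2 (Γ.rot (Γ.rot h)) ≠ p.2 (Γ.rot.symm (Γ.rot (Γ.rot h))) →
      (p.2 h = p.2 (Γ.rot.symm h) ∧ p.2 (Γ.rot h) ≠ p.2 (Γ.rot.symm (Γ.rot h)) ∧
        p.2 (Γ.rot (Γ.rot h)) ≠ p.2 (Γ.rot.symm (Γ.rot (Γ.rot h)))) ∨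
      (p.2 h ≠ p.2 (Γ.rot.symm h) ∧ p.2 (Γ.rot h) = p.2 (Γ.rot.symm (Γ.rot h)) ∧
        p.2 (Γ.rot (Γ.rot h)) ≠ p.2 (Γ.rot.symm (Γ.rot (Γ.rot h)))) ∨
      (p.2 h ≠ p.2 (Γ.rot.symm h) ∧ p.2 (Γ.rot h) ≠ p.2 (Γ.rot.symm (Γ.rot h)) ∧
        p.2 (Γ.rot (Γ.rot h)) = p.2 (Γ.rot.symm (Γ.rot (Γ.rot h)))) := by
    intro p h
    simp only [hrot, hrot3]
    generalize p.2 h = a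
    generalize p.2 (Γ.rot h) = b
    generalize p.2 (Γ.rot (Γ.rot h)) = c
    revert a b c
    decide
  have hprop : ∀ x : (Σ M : perfectMatchings G, {p // Γ.Matches (M : Set β) p}),
      Γ.IsProperCornerColoring x.2.1 := by
    rintro ⟨⟨M, hM⟩, p, hp⟩
    refine ⟨hp.1, fun v => ?_⟩
    obtain ⟨q, hv, hq, hq1, hq2⟩ := Γ.exists_matched htri hM v
    exact ⟨Γ.rot q, by rw [vert_rot, hv], fun h => hq1 ((hp.2 _).1 h)⟩
  refine (Nat.card_congr (Equiv.ofBijective (fun x => ⟨x.2.1, hprop x⟩) ⟨?_, ?_⟩)).symm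
  · rintro ⟨⟨M, hM⟩, p, hp⟩ ⟨⟨M', hM'⟩, p', hp'⟩ h
    obtain rfl : p = p' := congrArg Subtype.val h
    obtain rfl : M = M' := by
      have hsub := (Γ.isPerfectMatching_iff.1 hM).1
      have hsub' := (Γ.isPerfectMatching_iff.1 hM').1
      ext e
      constructor
      · intro he
        obtain ⟨k, rfl⟩ := Γ.exists_edge_eq (hsub he)
        rwa [← hp'.2, hp.2]
      · intro he
        obtain ⟨k, rfl⟩ := Γ.exists_edge_eq (hsub' he)
        rwa [← hp.2, hp'.2]
    rfl
  · rintro ⟨p, hp, hproper⟩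
    let M : Set β := {e | ∃ h, (Γ.edge h : β) = e ∧ p.2 h = p.2 (Γ.rot.symm h)}
    have hmem : ∀ h, p.2 h = p.2 (Γ.rot.symm h) ↔ (Γ.edge h : β) ∈ M := by
      intro h
      refine ⟨fun h1 => ⟨h, rfl, h1⟩, ?_⟩
      rintro ⟨k, hk, h1⟩
      rcases (Γ.edge_val_eq_iff k h).1 hk with rfl | rfl
      · exact h1
      · exact (hp.opp k).2 h1
    have hM : IsPerfectMatching G M := by
      refine Γ.isPerfectMatching_iff.2 ⟨?_, fun v => ?_⟩
      · rintro _ ⟨h, rfl, -⟩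
        exact (Γ.edge h).2
      · obtain ⟨h, hv, hne⟩ := hproper v
        have hall : ∀ k, Γ.vert k = v → k = h ∨ k = Γ.rot h ∨ k = Γ.rot (Γ.rot h) :=
          fun k hk => (Γ.vert_eq_iff_rot htri h k).1 (hk.trans hv.symm)
        simp only [← hmem]
        rcases hsides p h (Or.inl hne) with ⟨h1, h2, h3⟩ | ⟨h1, h2, h3⟩ | ⟨h1, h2, h3⟩
        · exact absurd h1 hne
        · refine ⟨Γ.rot h, ⟨by rw [vert_rot, hv], h2⟩, ?_⟩
          rintro k ⟨hk, hk'⟩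
          rcases hall k hk with rfl | rfl | rfl
          · exact absurd hk' h1
          · rfl
          · exact absurd hk' h3
        · refine ⟨Γ.rot (Γ.rot h), ⟨by rw [vert_rot, vert_rot, hv], h3⟩, ?_⟩
          rintro k ⟨hk, hk'⟩
          rcases hall k hk with rfl | rfl | rfl
          · exact absurd hk' h1
          · exact absurd hk' h2
          · rfl
    exact ⟨⟨⟨M, hM⟩, p, hp, hmem⟩, rfl⟩

variable {M : Set β} (hM : IsPerfectMatching G M)
include hM

theorem exists_eq_rot (k : H) : ∃ p, (Γ.edge p : β) ∈ M ∧
    (Γ.edge (Γ.rot p) : β) ∉ M ∧ (Γ.edge (Γ.rot (Γ.rot p)) : β) ∉ M ∧ Γ.vert p = Γ.vert k ∧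
    (k = p ∨ k = Γ.rot p ∨ k = Γ.rot (Γ.rot p)) := by
  obtain ⟨p, hv, hp, h1, h2⟩ := Γ.exists_matched htri hM (Γ.vert k)
  exact ⟨p, hp, h1, h2, hv, (Γ.vert_eq_iff_rot htri p k).1 hv.symm⟩

omit hM in
theorem Matches.rot {p : (V(G) → Bool) × (H → Bool)} (hp : Γ.Matches M p) {q : H}
    (hq : (Γ.edge q : β) ∈ M) (h1 : (Γ.edge (Γ.rot q) : β) ∉ M) :
    p.2 (Γ.rot q) = !p.2 q ∧ p.2 (Γ.rot (Γ.rot q)) = p.2 q := by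
  rw [← hp.2, Γ.rot.symm_apply_apply] at h1
  rw [← hp.2, Γ.rot_symm_eq htri] at hq
  exact ⟨Bool.eq_not.2 h1, hq.symm⟩

/-- The bijection records the color `a` along each edge of `M` and the orientation `g = f xor ν` of
the unmatched half-edges. Conversely, at a vertex with matched half-edge `q` the two corners next to
`q` have the color of its edge and the opposite corner has the other color; comparison with `g` then
gives `ν`. -/
theorem card_matches : Nat.card {p // Γ.Matches M p} =
    2 ^ M.ncard * 2 ^ (cyclesOfCompl G M).ncard := by
  classical
  have hsub := (Γ.isPerfectMatching_iff.1 hM).1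
  have hrot := Γ.rot_symm_eq htri
  have hrot3 := Γ.rot_rot_rot htri
  choose s hs using fun e : M => Γ.exists_edge_eq (hsub e.2)
  have hfin : Finite M := Finite.of_injective s fun e f hef =>
    Subtype.ext (by rw [← hs e, ← hs f, hef])
  have hfs : ∀ p, Γ.Matches M p → ∀ h (hh : (Γ.edge h : β) ∈ M), p.2 (s ⟨_, hh⟩) = p.2 h := by
    intro p hp h hh
    rcases (Γ.edge_val_eq_iff (s ⟨_, hh⟩) h).1 (hs _) with h1 | h1
    · rw [← h1]
    · conv_rhs => rw [h1]
      exact ((hp.opp _).1 ((hs ⟨_, hh⟩).symm ▸ hh)).symm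
  have htwo : Nat.card (M → Bool) = 2 ^ M.ncard := by
    rw [Nat.card_fun, Nat.card_eq_fintype_card (α := Bool), Fintype.card_bool,
      Nat.card_coe_set_eq]
  rw [← Γ.card_orientations htri hM, ← htwo, ← Nat.card_prod]
  refine Nat.card_congr (Equiv.ofBijective (fun p => (fun e => p.1.2 (s e),
    ⟨fun n => xor (p.1.2 n.1) (p.1.1 (Γ.vert n.1)), fun n => ?_, fun n => ?_⟩)) ⟨?_, ?_⟩)
  · rw [Bool.xor_true]
    exact (p.2.opp n.1).2 n.2
  · rw [Bool.xor_true]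
    obtain ⟨q, hq, h1, h2, hv, hn⟩ := Γ.exists_rot_eq htri hM n
    obtain ⟨e1, e2⟩ := Γ.unmatchedTurn_rot htri hq h1 h2
    obtain ⟨f1, f2⟩ := Matches.rot Γ htri p.2 hq h1
    rcases hn with rfl | rfl
    · rw [e1]
      simp [f1, f2, vert_rot]
    · rw [e2]
      simp [f1, f2, vert_rot]
  · rintro ⟨⟨ν, f⟩, hp⟩ ⟨⟨ν', f'⟩, hp'⟩ h
    simp only [Prod.mk.injEq, Subtype.mk.injEq] at h
    obtain ⟨h1, h2⟩ := h
    have hmat : ∀ q, (Γ.edge q : β) ∈ M → f q = f' q := fun q hq => by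
      have e1 := hfs _ hp q hq
      have e2 := hfs _ hp' q hq
      exact e1.symm.trans ((congrFun h1 ⟨_, hq⟩).trans e2)
    have hf : f = f' := by
      funext k
      obtain ⟨q, hq, h1, h2, hv, hk⟩ := Γ.exists_eq_rot htri hM k
      obtain ⟨e1, e2⟩ := Matches.rot Γ htri hp hq h1
      obtain ⟨e1', e2'⟩ := Matches.rot Γ htri hp' hq h1
      dsimp only at e1 e2 e1' e2'
      rcases hk with rfl | rfl | rfl
      · exact hmat _ hq
      · rw [e1, e1', hmat _ hq]
      · rw [e2, e2', hmat _ hq]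
    subst hf
    refine Subtype.ext (Prod.ext (funext fun v => ?_) rfl)
    obtain ⟨q, rfl, hq, hq1, hq2⟩ := Γ.exists_matched htri hM v
    have h3 := congrFun h2 ⟨_, hq1⟩
    simpa [vert_rot] using h3
  · rintro ⟨a, g, hgτ, hgσ⟩
    choose q hqv hq hq1 hq2 using Γ.exists_matched htri hM
    let b : V(G) → Bool := fun v => a ⟨_, hq v⟩
    let f : H → Bool := fun h => if h = Γ.rot (q (Γ.vert h)) then !b (Γ.vert h) else b (Γ.vert h)
    -- Solved from `g = f xor ν` at `rot (rot q)`, where `f` equals `b`. The equation at `rot q`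
    -- then holds because both `g` and `f` flip there.
    let ν : V(G) → Bool := fun v => xor (g ⟨_, hq2 v⟩) (b v)
    have hfq : ∀ v, f (q v) = b v ∧ f (Γ.rot (q v)) = (!b v) ∧ f (Γ.rot (Γ.rot (q v))) = b v := by
      intro v
      simp only [f, vert_rot, hqv]
      rw [if_neg (Γ.rot_ne htri _).symm, if_neg (Γ.rot_ne htri _)]
      simp
    have hcase : ∀ h, h = q (Γ.vert h) ∨ h = Γ.rot (q (Γ.vert h)) ∨
        h = Γ.rot (Γ.rot (q (Γ.vert h))) := fun h =>
      (Γ.vert_eq_iff_rot htri _ h).1 (hqv _).symm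
    have hmem : ∀ h, f h = f (Γ.rot.symm h) ↔ (Γ.edge h : β) ∈ M := by
      intro h
      rw [hrot]
      obtain ⟨e1, e2, e3⟩ := hfq (Γ.vert h)
      rcases hcase h with h1 | h1 | h1
      · rw [h1, e1, e3]
        simp [hq]
      · rw [h1, hrot3, e1, e2]
        simp [hq1]
      · rw [h1, hrot3, e2, e3]
        simp [hq2]
    have hg : ∀ h (hh : (Γ.edge h : β) ∉ M), xor (f h) (ν (Γ.vert h)) = g ⟨h, hh⟩ := by
      intro h hh
      obtain ⟨e1, e2, e3⟩ := hfq (Γ.vert h)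
      obtain ⟨t1, t2⟩ := Γ.unmatchedTurn_rot htri (hq (Γ.vert h)) (hq1 _) (hq2 _)
      rcases hcase h with h1 | h1 | h1
      · exact absurd (h1 ▸ hq (Γ.vert h)) hh
      · have h2 : (⟨h, hh⟩ : Γ.Unmatched M) = ⟨_, hq1 (Γ.vert h)⟩ := Subtype.ext h1
        have h3 := hgσ ⟨_, hq2 (Γ.vert h)⟩
        rw [t2] at h3
        rw [h2, h3]
        have h4 : f h = !b (Γ.vert h) := by rw [← e2, ← h1]
        simp only [ν, h4]
        cases b (Γ.vert h) <;> simp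
      · have h2 : (⟨h, hh⟩ : Γ.Unmatched M) = ⟨_, hq2 (Γ.vert h)⟩ := Subtype.ext h1
        have h4 : f h = b (Γ.vert h) := by rw [← e3, ← h1]
        rw [h2]
        simp only [ν, h4]
        cases b (Γ.vert h) <;> simp
    have ha : ∀ h (hh : (Γ.edge h : β) ∈ M), f h = a ⟨_, hh⟩ := by
      intro h hh
      obtain ⟨e1, e2, e3⟩ := hfq (Γ.vert h)
      rcases hcase h with h1 | h1 | h1
      · have h4 : f h = b (Γ.vert h) := by rw [← e1, ← h1]
        rw [h4]
        exact congrArg a (Subtype.ext (congrArg (fun k => (Γ.edge k : β)) h1.symm))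
      · exact absurd (h1 ▸ hh) (hq1 _)
      · exact absurd (h1 ▸ hh) (hq2 _)
    have hp : Γ.Matches M (ν, f) := by
      refine ⟨fun h => ?_, hmem⟩
      by_cases hh : (Γ.edge h : β) ∈ M
      · have hh' : (Γ.edge (Γ.opp h) : β) ∈ M := by rwa [edge_opp]
        have e1 := (hmem h).2 hh
        have e2 := (hmem _).2 hh'
        have e3 : f (Γ.opp h) = f h := by
          rw [ha _ hh, ha _ hh']
          exact congrArg a (Subtype.ext (congrArg (Subtype.val : E(G) → β) (Γ.edge_opp h)))
        simp only [outerColor, innerColor, ← e1, ← e2, e3, ite_self]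
      · have hh' : (Γ.edge (Γ.opp h) : β) ∉ M := by rwa [edge_opp]
        have e1 := mt (hmem h).1 hh
        have e2 := mt (hmem _).1 hh'
        have e3 := hg h hh
        have e4 := hg _ hh'
        have e5 := hgτ ⟨h, hh⟩
        rw [show Γ.unmatchedOpp M ⟨h, hh⟩ = ⟨Γ.opp h, hh'⟩ from rfl, ← e3, ← e4] at e5
        revert e1 e2 e5
        simp only [outerColor, innerColor]
        generalize f h = x1
        generalize f (Γ.rot.symm h) = x2
        generalize f (Γ.opp h) = x3
        generalize f (Γ.rot.symm (Γ.opp h)) = x4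
        generalize ν (Γ.vert h) = x5
        generalize ν (Γ.vert (Γ.opp h)) = x6
        revert x1 x2 x3 x4 x5 x6
        decide
    refine ⟨⟨(ν, f), hp⟩, Prod.ext (funext fun e => ?_) (Subtype.ext (funext fun n => ?_))⟩
    · have h1 : (Γ.edge (s e) : β) ∈ M := (hs e).symm ▸ e.2
      exact (ha _ h1).trans (congrArg a (Subtype.ext (hs e)))
    · exact hg n.1 n.2

end

end OrientedRibbonGraph
end VertexHomology

namespace VertexHomology
namespace OrientedRibbonGraph

variable {α β H : Type*} {G : Graph α β} (Γ : OrientedRibbonGraph G H)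

/-! ### Three-edge-colorings -/

theorem edge_ne_of_isThreeEdgeColoring {c : E(G) → Fin 3} (hc : IsThreeEdgeColoring G c) {h k : H}
    (hv : Γ.vert k = Γ.vert h) (hne : k ≠ h) : c (Γ.edge h) ≠ c (Γ.edge k) := by
  have hedge : Γ.edge h ≠ Γ.edge k := by
    intro h1
    rcases (Γ.edge_eq_iff h k).1 h1 with h2 | h2
    · exact hne h2
    · exact hc.1 (Γ.edge h) (Γ.vert h) (Γ.isLoopAt_iff.2 ⟨rfl, by rw [← h2, hv]⟩)
  exact hc.2 _ _ (Γ.vert h) hedge (Γ.inc_iff.2 ⟨h, rfl, rfl⟩)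
    (Γ.inc_iff.2 ⟨k, rfl, congrArg Subtype.val hv⟩)

variable [Finite H] (htri : IsTrivalent G)
include htri

include Γ in
theorem isPerfectMatching_of_isThreeEdgeColoring {c : E(G) → Fin 3}
    (hc : IsThreeEdgeColoring G c) : IsPerfectMatching G (Subtype.val '' {e | c e = 0}) := by
  have hmem : ∀ h, (Γ.edge h : β) ∈ Subtype.val '' {e | c e = 0} ↔ c (Γ.edge h) = 0 := fun h =>
    Subtype.val_injective.mem_set_image
  refine Γ.isPerfectMatching_iff.2 ⟨?_, fun v => ?_⟩
  · rintro _ ⟨e, -, rfl⟩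
    exact e.2
  · simp only [hmem]
    refine existsUnique_of_exists_of_unique ?_ ?_
    · obtain ⟨h, hv⟩ := Γ.exists_vert_eq htri v
      have h1 := Γ.edge_ne_of_isThreeEdgeColoring hc (Γ.vert_rot h) (Γ.rot_ne htri h)
      have h2 := Γ.edge_ne_of_isThreeEdgeColoring hc (Γ.vert_rot (Γ.rot h))
        (Γ.rot_ne htri (Γ.rot h))
      have h3 := Γ.edge_ne_of_isThreeEdgeColoring hc
        ((Γ.vert_rot (Γ.rot h)).trans (Γ.vert_rot h)) (Γ.rot_rot_ne htri h)
      have key : ∀ x y z : Fin 3, x ≠ y → y ≠ z → x ≠ z → x = 0 ∨ y = 0 ∨ z = 0 := by decide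
      rcases key _ _ _ h1 h2 h3 with h4 | h4 | h4
      · exact ⟨h, hv, h4⟩
      · exact ⟨_, by rw [vert_rot, hv], h4⟩
      · exact ⟨_, by rw [vert_rot, vert_rot, hv], h4⟩
    · rintro h k ⟨hv, hh⟩ ⟨kv, hk⟩
      by_contra hne
      exact Γ.edge_ne_of_isThreeEdgeColoring hc (hv.trans kv.symm) hne (hk.trans hh.symm)

open scoped Classical in
/-- The edge coloring given by a perfect matching and a coloring of its complement. -/
noncomputable def edgeColoring (M : Set β) (k : Γ.Unmatched M → Bool) (e : E(G)) : Fin 3 :=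
  if h : (Γ.edge (Γ.edge_surjective e).choose : β) ∈ M then 0
  else if k ⟨_, h⟩ = true then 1 else 2

-- `edgeColoring` reads `k` at an arbitrarily chosen half of the edge; invariance under
-- `unmatchedOpp` makes the choice irrelevant.
omit [Finite H] htri in
theorem edgeColoring_edge {M : Set β} {k : Γ.Unmatched M → Bool}
    (hk : ∀ n, k (Γ.unmatchedOpp M n) = k n) (h : H) :
    ((Γ.edge h : β) ∈ M → Γ.edgeColoring M k (Γ.edge h) = 0) ∧
    ∀ hh : (Γ.edge h : β) ∉ M,
      Γ.edgeColoring M k (Γ.edge h) = if k ⟨h, hh⟩ = true then 1 else 2 := by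
  have h0 := (Γ.edge_surjective (Γ.edge h)).choose_spec
  unfold edgeColoring
  generalize (Γ.edge_surjective (Γ.edge h)).choose = h' at h0
  constructor
  · intro hh
    rw [dif_pos (by rwa [h0])]
  · intro hh
    have hh' : (Γ.edge h' : β) ∉ M := by rwa [h0]
    rw [dif_neg hh']
    have h1 : k ⟨h', hh'⟩ = k ⟨h, hh⟩ := by
      rcases (Γ.edge_unmatched_eq_iff ⟨h, hh⟩ ⟨h', hh'⟩).1 (congrArg Subtype.val h0.symm)
        with h2 | h2
      · rw [h2]
      · rw [h2, hk]
    rw [h1]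

theorem isThreeEdgeColoring_edgeColoring {M : Set β} (hM : IsPerfectMatching G M)
    (k : Labeling (Γ.unmatchedOpp M) (Γ.unmatchedTurn M) false true) :
    IsThreeEdgeColoring G (Γ.edgeColoring M k.1) := by
  have hτ : ∀ n, k.1 (Γ.unmatchedOpp M n) = k.1 n := fun n => by rw [k.2.1, Bool.xor_false]
  have hσ : ∀ n, k.1 (Γ.unmatchedTurn M n) = !k.1 n := fun n => by rw [k.2.2, Bool.xor_true]
  have huniq := (Γ.isPerfectMatching_iff.1 hM).2
  constructor
  · intro e x hx
    obtain ⟨h, rfl⟩ := Γ.edge_surjective e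
    obtain ⟨h1, h2⟩ := Γ.isLoopAt_iff.1 hx
    have h3 : Γ.vert (Γ.opp h) = Γ.vert h := Subtype.ext (h2.trans h1.symm)
    by_cases hh : (Γ.edge h : β) ∈ M
    · exact Γ.opp_ne h ((huniq (Γ.vert h)).unique ⟨h3, by rwa [edge_opp]⟩ ⟨rfl, hh⟩)
    -- At a loop outside `M` the maps `unmatchedOpp` and `unmatchedTurn` coincide, but `k` is
    -- constant along the first and flips along the second.
    · rcases (Γ.vert_eq_iff_unmatched htri hM ⟨h, hh⟩ (Γ.unmatchedOpp M ⟨h, hh⟩)).1 h3 with h4 | h4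
      · exact Γ.unmatchedOpp_ne _ h4
      · have h5 := hτ ⟨h, hh⟩
        rw [h4, hσ] at h5
        exact Bool.not_ne_self _ h5
  · intro e f x hef he hf
    obtain ⟨h, h1, h2⟩ := Γ.inc_iff.1 he
    obtain ⟨l, h3, h4⟩ := Γ.inc_iff.1 hf
    obtain rfl : Γ.edge h = e := Subtype.ext h1
    obtain rfl : Γ.edge l = f := Subtype.ext h3
    have hv : Γ.vert l = Γ.vert h := Subtype.ext (h4.trans h2.symm)
    have hne : l ≠ h := fun h5 => hef (by rw [h5])
    obtain ⟨a1, a2⟩ := Γ.edgeColoring_edge hτ h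
    obtain ⟨b1, b2⟩ := Γ.edgeColoring_edge hτ l
    by_cases hh : (Γ.edge h : β) ∈ M
    · by_cases hl : (Γ.edge l : β) ∈ M
      · exact absurd ((huniq (Γ.vert h)).unique ⟨hv, hl⟩ ⟨rfl, hh⟩) hne
      · rw [a1 hh, b2 hl]
        split_ifs <;> decide
    · by_cases hl : (Γ.edge l : β) ∈ M
      · rw [a2 hh, b1 hl]
        split_ifs <;> decide
      · rcases (Γ.vert_eq_iff_unmatched htri hM ⟨h, hh⟩ ⟨l, hl⟩).1 hv with h5 | h5
        · exact absurd (congrArg Subtype.val h5) hne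
        · rw [a2 hh, b2 hl, h5, hσ]
          cases k.1 ⟨h, hh⟩ <;> decide

/-- The matching is recovered as the set of edges of color `0`, and `k` distinguishes color `1` from
color `2` on the rest. -/
theorem numThreeEdgeColorings_eq : numThreeEdgeColorings G =
    Nat.card (Σ M : perfectMatchings G,
      Labeling (Γ.unmatchedOpp (M : Set β)) (Γ.unmatchedTurn (M : Set β)) false true) := by
  rw [numThreeEdgeColorings, ← Nat.card_coe_set_eq]
  refine (Nat.card_congr (Equiv.ofBijective (fun x => ⟨Γ.edgeColoring x.1.1 x.2.1,
    Γ.isThreeEdgeColoring_edgeColoring htri x.1.2 x.2⟩) ⟨?_, ?_⟩)).symm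
  · rintro ⟨⟨M, hM⟩, k, hkτ, hkσ⟩ ⟨⟨M', hM'⟩, k', hkτ', hkσ'⟩ heq
    have heq' : Γ.edgeColoring M k = Γ.edgeColoring M' k' := congrArg Subtype.val heq
    simp only [Bool.xor_false] at hkτ hkτ'
    have hzero : ∀ {M : Set β} {k : Γ.Unmatched M → Bool} (_ : IsPerfectMatching G M)
        (_ : ∀ n, k (Γ.unmatchedOpp M n) = k n) (e : β),
        e ∈ M ↔ ∃ he : e ∈ E(G), Γ.edgeColoring M k ⟨e, he⟩ = 0 := by
      intro M k hM hk e
      constructor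
      · intro he
        have he' := (Γ.isPerfectMatching_iff.1 hM).1 he
        obtain ⟨h, hh⟩ := Γ.edge_surjective ⟨e, he'⟩
        refine ⟨he', ?_⟩
        rw [← hh]
        exact (Γ.edgeColoring_edge hk h).1 (by rwa [hh])
      · rintro ⟨he, h0⟩
        obtain ⟨h, hh⟩ := Γ.edge_surjective ⟨e, he⟩
        rw [← hh] at h0
        by_contra heM
        rw [(Γ.edgeColoring_edge hk h).2 (by rwa [hh])] at h0
        revert h0
        split_ifs <;> decide
    obtain rfl : M = M' := by
      ext e
      rw [hzero hM hkτ, hzero hM' hkτ', heq']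
    obtain rfl : k = k' := by
      funext n
      have h1 := congrFun heq' (Γ.edge n.1)
      rw [(Γ.edgeColoring_edge hkτ n.1).2 n.2, (Γ.edgeColoring_edge hkτ' n.1).2 n.2] at h1
      revert h1
      cases k n <;> cases k' n <;> decide
    rfl
  · rintro ⟨c, hc⟩
    have hM := Γ.isPerfectMatching_of_isThreeEdgeColoring htri hc
    set M : Set β := Subtype.val '' {e | c e = 0} with hMdef
    have hmem : ∀ h, (Γ.edge h : β) ∈ M ↔ c (Γ.edge h) = 0 := fun h =>
      Subtype.val_injective.mem_set_image
    let k : Γ.Unmatched M → Bool := fun n => decide (c (Γ.edge n.1) = 1)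
    have hτ : ∀ n, k (Γ.unmatchedOpp M n) = k n := fun n => by
      simp only [k, unmatchedOpp, edge_opp]
    have hσ : ∀ n, k (Γ.unmatchedTurn M n) = !k n := fun n => by
      have h1 := Γ.edge_ne_of_isThreeEdgeColoring hc
        ((Γ.vert_eq_iff_unmatched htri hM n _).2 (Or.inr rfl))
        fun h => Γ.unmatchedTurn_ne htri hM n (Subtype.ext h)
      have h2 := mt (hmem _).2 n.2
      have h3 := mt (hmem _).2 (Γ.unmatchedTurn M n).2
      have key : ∀ x y : Fin 3, x ≠ y → x ≠ 0 → y ≠ 0 → decide (y = 1) = !decide (x = 1) := by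
        decide
      exact key _ _ h1 h2 h3
    refine ⟨⟨⟨M, hM⟩, k, fun n => by rw [hτ, Bool.xor_false], fun n => by
      rw [hσ, Bool.xor_true]⟩, Subtype.ext (funext fun e => ?_)⟩
    obtain ⟨h, rfl⟩ := Γ.edge_surjective e
    dsimp only
    by_cases hh : (Γ.edge h : β) ∈ M
    · rw [(Γ.edgeColoring_edge hτ h).1 hh, (hmem h).1 hh]
    · rw [(Γ.edgeColoring_edge hτ h).2 hh]
      have h2 := mt (hmem _).2 hh
      have key : ∀ x : Fin 3, x ≠ 0 → (if decide (x = 1) = true then 1 else 2) = x := by decide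
      exact key _ h2

/-! ### The total matching polynomial for two colors -/

theorem totalMatchingPolynomial_two [Finite V(G)] [Fintype (perfectMatchings G)] :
    Γ.totalMatchingPolynomial 2 = 2 ^ (V(G).ncard / 2) *
      ∑ M : perfectMatchings G, 2 ^ (cyclesOfCompl G (M : Set β)).ncard := by
  rw [Γ.totalMatchingPolynomial_eq_card htri, Γ.card_properColorings,
    Γ.card_properCornerColorings htri, Nat.card_sigma, Finset.mul_sum]
  refine Finset.sum_congr rfl fun M _ => ?_
  -- Since `|V| = 2 |M|`, the truncated division `V(G).ncard / 2` is exact.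
  rw [Γ.card_matches htri M.2, Γ.ncard_vertexSet_eq M.2, Nat.mul_div_cancel_left _ two_pos]

theorem numThreeEdgeColorings_eq_sum [Fintype (perfectMatchings G)] :
    numThreeEdgeColorings G = ∑ M : perfectMatchings G,
      Nat.card (Labeling (Γ.unmatchedOpp (M : Set β)) (Γ.unmatchedTurn (M : Set β)) false true) := by
  rw [Γ.numThreeEdgeColorings_eq htri, Nat.card_sigma]

end OrientedRibbonGraph
end VertexHomology

theorem mainTheorem10 {α β H : Type*} (G : Graph α β) [Finite V(G)] [Finite E(G)] [Finite H]
    (hconn : VertexHomology.IsConnected G) (htri : VertexHomology.IsTrivalent G)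
    (Γ : VertexHomology.OrientedRibbonGraph G H) :
    ((VertexHomology.perfectMatchings G).Nonempty →
      Γ.totalMatchingPolynomial 2 = 2 ^ (V(G).ncard / 2) *
        ∑ᶠ M ∈ VertexHomology.perfectMatchings G,
          2 ^ (VertexHomology.cyclesOfCompl G M).ncard) ∧
    (VertexHomology.perfectMatchings G = ∅ → Γ.totalMatchingPolynomial 2 = 0) ∧
    2 ^ (V(G).ncard / 2) * VertexHomology.numThreeEdgeColorings G ≤
      Γ.totalMatchingPolynomial 2 ∧
    ((∀ M ∈ VertexHomology.perfectMatchings G, VertexHomology.IsEvenMatching G M) →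
      Γ.totalMatchingPolynomial 2 =
        2 ^ (V(G).ncard / 2) * VertexHomology.numThreeEdgeColorings G) := by
  have hfin : (VertexHomology.perfectMatchings G).Finite :=
    (Set.toFinite E(G)).finite_subsets.subset fun M hM => (Γ.isPerfectMatching_iff.1 hM).1
  have := hfin.fintype
  have hTM := Γ.totalMatchingPolynomial_two htri
  have hcol := Γ.numThreeEdgeColorings_eq_sum htri
  refine ⟨fun _ => ?_, fun hempty => ?_, ?_, fun heven => ?_⟩
  · rw [hTM, ← finsum_set_coe_eq_finsum_mem, finsum_eq_sum_of_fintype]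
  · have : IsEmpty (VertexHomology.perfectMatchings G) := Set.isEmpty_coe_sort.2 hempty
    rw [hTM, Finset.univ_eq_empty, Finset.sum_empty, mul_zero]
  -- Both sides are sums over the perfect matchings and are compared term by term.
  · rw [hTM, hcol]
    exact Nat.mul_le_mul_left _
      (Finset.sum_le_sum fun M _ => Γ.card_alternatingColorings_le htri M.2)
  · rw [hTM, hcol]
    congr 1
    exact Finset.sum_congr rfl fun M _ =>
      (Γ.card_alternatingColorings htri M.2 (heven M M.2)).symm
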